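/- Let $\mathbb{C}^+=\{z=x+is : s>0\}$ and $d\mu^+(z)=s^{-2}\,dx\,ds$. Let $\widehat f(\xi)=\int_{\mathbb R} f(t)e^{-i\xi t}\,dt$ denote the Fourier transform, extended to $L^2(\mathbb R)$, and let $H^2(\mathbb{C}^+)$ be the Hardy space of the upper half-plane, identified through boundary values with the space of all $f\in L^2(\mathbb R)$ such that $\widehat f(\xi)=0$ for almost every $\xi<0$. For $\psi,f\in H^2(\mathbb{C}^+)$ the wavelet transform is $$W_\psi f(z)=\int_{\mathbb R} f(t)\,\overline{s^{-1/2}\,\psi\big((t-x)/s\big)}\,dt,\qquad z=x+is\in\mathbb{C}^+ .$$ For $\alpha>0$ and $n\in\mathbb N_0$ let $\psi_n^\alpha\in H^2(\mathbb C^+)$ be the function with $$\widehat{\psi_n^\alpha}(t)=\sqrt{\frac{2^{\alpha+2}\pi\, n!}{\Gamma(n+\alpha+1)}}\;t^{\alpha/2}e^{-t}L_n^\alpha(2t)\quad(t>0),\qquad L_n^\alpha(t)=\sum_{k=0}^n\frac{(-1)^k}{k!}\binom{n+\alpha}{n-k}t^k .$$ Let $$P_n^{(a,b)}(x)=\frac{\Gamma(n+a+1)}{n!\,\Gamma(n+a+b+1)}\sum_{k=0}^n\binom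 nk\frac{\Gamma(n+k+a+b+1)}{\Gamma(k+a+1)}\Big(\frac{x-1}{2}\Big)^k$$ be the Jacobi polynomials and, with $M=\max(n,m)$ and $q=\min(n,m)$, let $$Z_{n,m}^\alpha(t)=\sqrt{\frac{\Gamma(M+\alpha+1)\,q!}{\Gamma(q+\alpha+1)\,M!}}\;(-t)^{-q}\,P_{q}^{(|n-m|,\alpha)}(1-2t).$$ For $0<R<1$ let $\mathcal D_R=\{w\in\mathbb C^+ : |(i-w)/(i-\overline w)|<R\}$ be the pseudohyperbolic disc of radius $R$ centred at $i$. Theorem. Let $\alpha>0$, $0<R<1$ and $n,m,k\in\mathbb N_0$. Then $$\int_{\mathcal D_R}W_{\psi_n^\alpha}\psi_m^\alpha(z)\,\overline{W_{\psi_n^\alpha}\psi_k^\alpha(z)}\,d\mu^+(z)=C_{m,n}^\alpha(R)\,\delta_{m,k},$$ where $$C_{n,m}^\alpha(R)=4\pi\int_0^{R^2}r^{n+m}(1-r)^{\alpha-1}Z_{n,m}^\alpha(r)^2\,dr ,$$ and all these integrals converge absolutely. For $m=n$ the constant $C_n^\alpha(R)=C_{n,n}^\alpha(R)$ is $$C_n^\alpha(R)=4\pi\int_0^{R^2}(1-r)^{\alpha-1}P_n^{(0,\alpha)}(1-2r)^2\,dr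 .$$ -/

import Mathlib

open MeasureTheory Set
open scoped FourierTransform UpperHalfPlane ComplexConjugate

noncomputable section

namespace WaveletOrth

/-- The generalized Laguerre polynomial
`L_n^α(t) = ∑_{k=0}^n (-1)^k / k! * binom(n+α, n-k) * t^k`. -/
def laguerre (n : ℕ) (α t : ℝ) : ℝ :=
  ∑ k ∈ Finset.range (n + 1),
    (-1) ^ k / (k.factorial : ℝ) * Ring.choose ((n : ℝ) + α) (n - k) * t ^ k

/-- The Jacobi polynomial `P_n^{(a,b)}(x)`. -/
def jacobi (n : ℕ) (a b x : ℝ) : ℝ :=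
  Real.Gamma (n + a + 1) / (n.factorial * Real.Gamma (n + a + b + 1)) *
    ∑ k ∈ Finset.range (n + 1),
      (n.choose k : ℝ) * (Real.Gamma (n + k + a + b + 1) / Real.Gamma (k + a + 1)) *
        ((x - 1) / 2) ^ k

/-- The Zernike-type functions
`Z_{n,m}^α(t) = √(Γ(max+α+1) min! / (Γ(min+α+1) max!)) (-t)^{-min} P_min^{(|n-m|,α)}(1-2t)`,
where `max = max(n,m)` and `min = min(n,m)`. -/
def zernike (α : ℝ) (n m : ℕ) (t : ℝ) : ℝ :=
  Real.sqrt (Real.Gamma ((max n m : ℕ) + α + 1) * ((min n m).factorial : ℝ) /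
      (Real.Gamma ((min n m : ℕ) + α + 1) * ((max n m).factorial : ℝ))) *
    (-t) ^ (-((min n m : ℕ) : ℤ)) *
    jacobi (min n m) |(n : ℝ) - (m : ℝ)| α (1 - 2 * t)

/-- The Fourier transform `f̂(ξ) = ∫ f(t) e^{-iξt} dt` on `L²(ℝ)`. Mathlib's transform `𝓕` is the
`L²`-extension of `∫ f(t) e^{-2πiξt} dt`, hence the rescaling. -/
def fourierHat (f : Lp ℂ 2 (volume : Measure ℝ)) (ξ : ℝ) : ℂ :=
  (𝓕 f : Lp ℂ 2 (volume : Measure ℝ)) (ξ / (2 * Real.pi))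

/-- Rescaling by `2π` preserves statements that hold almost everywhere. -/
theorem ae_rescale {p : ℝ → Prop} (h : ∀ᵐ ξ, p ξ) : ∀ᵐ ξ : ℝ, p (ξ / (2 * Real.pi)) := by
  have hne : (2 * Real.pi)⁻¹ ≠ 0 := inv_ne_zero (by positivity)
  have hq : Measure.QuasiMeasurePreserving (fun ξ : ℝ => ξ * (2 * Real.pi)⁻¹) volume volume := by
    refine ⟨by fun_prop, ?_⟩
    rw [Real.map_volume_mul_right hne]
    exact Measure.smul_absolutelyContinuous
  simpa [div_eq_mul_inv] using hq.ae h

/-- The Hardy space `H²(ℂ⁺)`, realized by boundary values: all `f ∈ L²(ℝ)` whose Fourier transform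
vanishes almost everywhere on the negative half-line. -/
def hardySpace : Submodule ℂ (Lp ℂ 2 (volume : Measure ℝ)) where
  carrier := {f | ∀ᵐ ξ : ℝ, ξ < 0 → fourierHat f ξ = 0}
  add_mem' := by
    intro f g hf hg
    have h := ae_rescale (Lp.coeFn_add (𝓕 f : Lp ℂ 2 (volume : Measure ℝ)) (𝓕 g))
    filter_upwards [hf, hg, h] with ξ h1 h2 h3 hξ
    have h1 := h1 hξ
    have h2 := h2 hξ
    simp only [fourierHat] at h1 h2 ⊢
    rw [FourierTransform.fourier_add, h3, Pi.add_apply, h1, h2, add_zero]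
  zero_mem' := by
    have h := ae_rescale (Lp.coeFn_zero ℂ 2 (volume : Measure ℝ))
    filter_upwards [h] with ξ h1 hξ
    have h0 : (𝓕 (0 : Lp ℂ 2 (volume : Measure ℝ)) : Lp ℂ 2 (volume : Measure ℝ)) = 0 :=
      (Lp.fourierTransformₗᵢ ℝ ℂ).map_zero
    simp only [fourierHat, h0]
    exact h1
  smul_mem' := by
    intro c f hf
    have h := ae_rescale (Lp.coeFn_smul c (𝓕 f : Lp ℂ 2 (volume : Measure ℝ)))
    filter_upwards [hf, h] with ξ h1 h3 hξ
    have h1 := h1 hξ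
    simp only [fourierHat] at h1 ⊢
    rw [FourierTransform.fourier_smul, h3, Pi.smul_apply, h1, smul_zero]

/-- The Fourier transform of `ψ_n^α`:
`√(2^{α+2} π n! / Γ(n+α+1)) t^{α/2} e^{-t} L_n^α(2t)` for `t > 0`, and `0` for `t ≤ 0`. -/
def psiHat (α : ℝ) (n : ℕ) : ℝ → ℂ :=
  (Ioi (0 : ℝ)).indicator fun t =>
    ((Real.sqrt ((2 : ℝ) ^ (α + 2) * Real.pi * n.factorial / Real.Gamma (n + α + 1)) *
      t ^ (α / 2) * Real.exp (-t) * laguerre n α (2 * t) : ℝ) : ℂ)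

theorem measurable_psiHat (α : ℝ) (n : ℕ) : Measurable (psiHat α n) := by
  unfold psiHat laguerre
  refine Measurable.indicator ?_ measurableSet_Ioi
  fun_prop

theorem memLp_psiHat {α : ℝ} (hα : 0 < α) (n : ℕ) : MemLp (psiHat α n) 2 := by
  have key : ∀ k : ℕ, MemLp ((Ioi (0 : ℝ)).indicator fun t =>
      ((t ^ (α / 2 + k) * Real.exp (-t) : ℝ) : ℂ)) 2 := by
    intro k
    have hm : Measurable ((Ioi (0 : ℝ)).indicator fun t =>
        ((t ^ (α / 2 + k) * Real.exp (-t) : ℝ) : ℂ)) :=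
      Measurable.indicator (by fun_prop) measurableSet_Ioi
    rw [memLp_two_iff_integrable_sq_norm hm.aestronglyMeasurable]
    have h2 := integrableOn_rpow_mul_exp_neg_mul_rpow (p := 1) (s := α + 2 * k) (b := 2)
      (by have : (0 : ℝ) ≤ k := k.cast_nonneg
          linarith) one_pos two_pos
    rw [← integrable_indicator_iff measurableSet_Ioi] at h2
    refine h2.congr (Filter.Eventually.of_forall fun t => ?_)
    by_cases ht : 0 < t
    · have ht' : t ∈ Ioi (0 : ℝ) := ht
      simp only [indicator_of_mem ht', Complex.norm_real, Real.rpow_one, norm_mul, mul_pow,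
        Real.norm_eq_abs, sq_abs]
      rw [← Real.rpow_natCast (t ^ (α / 2 + (k : ℝ))), ← Real.rpow_mul ht.le,
        ← Real.exp_nat_mul]
      push_cast
      congr 2 <;> ring
    · have ht' : t ∉ Ioi (0 : ℝ) := ht
      simp [indicator_of_notMem ht']
  have hsum : psiHat α n = ∑ k ∈ Finset.range (n + 1),
      ((Real.sqrt ((2 : ℝ) ^ (α + 2) * Real.pi * n.factorial / Real.Gamma (n + α + 1)) *
        ((-1) ^ k / (k.factorial : ℝ) * Ring.choose ((n : ℝ) + α) (n - k) * 2 ^ k) : ℝ) : ℂ) •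
      ((Ioi (0 : ℝ)).indicator fun t => ((t ^ (α / 2 + k) * Real.exp (-t) : ℝ) : ℂ)) := by
    funext t
    rw [Finset.sum_apply]
    by_cases ht : 0 < t
    · have ht' : t ∈ Ioi (0 : ℝ) := ht
      simp only [psiHat, laguerre, indicator_of_mem ht', Pi.smul_apply, smul_eq_mul]
      rw [Finset.mul_sum, Complex.ofReal_sum]
      refine Finset.sum_congr rfl fun k _ => ?_
      rw [← Complex.ofReal_mul, Real.rpow_add ht, Real.rpow_natCast, mul_pow]
      congr 1
      ring
    · have ht' : t ∉ Ioi (0 : ℝ) := ht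
      simp [psiHat, indicator_of_notMem ht']
  rw [hsum]
  exact memLp_finsetSum' _ fun k _ => (key k).const_smul _

theorem memLp_psiHat_rescale {α : ℝ} (hα : 0 < α) (n : ℕ) :
    MemLp (fun ξ : ℝ => psiHat α n (2 * Real.pi * ξ)) 2 := by
  have h := memLp_psiHat hα n
  have hm := measurable_psiHat α n
  rw [memLp_two_iff_integrable_sq_norm hm.aestronglyMeasurable] at h
  have hm' : Measurable fun ξ : ℝ => psiHat α n (2 * Real.pi * ξ) :=
    hm.comp (measurable_const_mul _)
  rw [memLp_two_iff_integrable_sq_norm hm'.aestronglyMeasurable]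
  exact h.comp_mul_left' (by positivity)

/-- The element of `L²(ℝ)` with Fourier transform `psiHat α n`. -/
def psiLp (α : ℝ) (hα : 0 < α) (n : ℕ) : Lp ℂ 2 (volume : Measure ℝ) :=
  𝓕⁻ ((memLp_psiHat_rescale hα n).toLp)

theorem fourierHat_psiLp {α : ℝ} (hα : 0 < α) (n : ℕ) :
    ∀ᵐ ξ : ℝ, fourierHat (psiLp α hα n) ξ = psiHat α n ξ := by
  have h := ae_rescale (memLp_psiHat_rescale hα n).coeFn_toLp
  filter_upwards [h] with ξ hξ
  rw [fourierHat, psiLp, FourierTransform.fourier_fourierInv_eq, hξ]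
  congr 1
  field_simp

/-- The function `ψ_n^α ∈ H²(ℂ⁺)`, `α > 0`, determined by its Fourier transform `psiHat α n`. -/
def psi (α : ℝ) (hα : 0 < α) (n : ℕ) : hardySpace :=
  ⟨psiLp α hα n, by
    filter_upwards [fourierHat_psiLp hα n] with ξ h hξ
    rw [h, psiHat, indicator_of_notMem]
    exact not_lt.mpr hξ.le⟩

/-- The action `π(z)ψ(t) = s^{-1/2} ψ((t - x)/s)` of `z = x + is ∈ ℂ⁺`. -/
def affineAction (z : ℍ) (ψ : ℝ → ℂ) (t : ℝ) : ℂ :=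
  ((1 / Real.sqrt z.im : ℝ) : ℂ) * ψ ((t - z.re) / z.im)

/-- The continuous wavelet transform `W_ψ f(z) = ⟨f, π(z)ψ⟩ = ∫ f(t) conj(π(z)ψ(t)) dt`. -/
def waveletTransform (ψ f : hardySpace) (z : ℍ) : ℂ :=
  ∫ t : ℝ, (f : Lp ℂ 2 (volume : Measure ℝ)) t *
    conj (affineAction z (ψ : Lp ℂ 2 (volume : Measure ℝ)) t)

/-- The pseudohyperbolic disc of radius `R` centred at `z`. -/
def pseudoDisc (z : ℍ) (R : ℝ) : Set ℍ :=
  {w : ℍ | ‖((z : ℂ) - (w : ℂ)) / ((z : ℂ) - conj (w : ℂ))‖ < R}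

/-- The constant
`C_{n,m}^α(R) = 4π ∫_0^{R²} r^{n+m} (1-r)^{α-1} Z_{n,m}^α(r)² dr`. -/
def localConst (α : ℝ) (n m : ℕ) (R : ℝ) : ℝ :=
  4 * Real.pi * ∫ r in (0 : ℝ)..R ^ 2,
    r ^ (n + m) * (1 - r) ^ (α - 1) * zernike α n m r ^ 2

end WaveletOrth

end

/-!
Write `a = α + 1`. On the Fourier side the wavelet transform `W_{ψ_n} ψ_m (x + is)` is an integral
of `ξ^α e^{-pξ} L_m(2ξ) L_n(2sξ)` over `ξ > 0`, where `p = 1 + s - ix` (`fourierInv_toLp_ae_eq`,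
`integral_mul_conj_affineAction`). Termwise it is a Laplace transform of powers
(`integral_rpow_mul_cexp_neg`), and the resulting double sum over the coefficients of the two
Laguerre polynomials collapses, by the Chu–Vandermonde identity, to a single sum in the quantities
`1 - 2/p`, `1 - 2s/p` and `4s/p²` (`double_sum_Gamma_eq`).

In the disc coordinate `ζ = (z - i)/(z + i)` these quantities are `ζ`, `ε conj ζ` and `-ε (1 -
|ζ|²)` with a unimodular `ε`. Hence, up to a power of `1 - |ζ|²` and to phases that do not depend
on `m`, the wavelet transform is the polynomial `discPoly α m n ζ` (`waveletTransform_cayleyInv`),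
which in polar coordinates is `e^{i(m-n)θ}` times a real function of `|ζ|` (`discPoly_polar`).

The Cayley transform carries the invariant measure to `4 (1 - |ζ|²)⁻² dζ` and the pseudohyperbolic
disc to `|ζ| < R` (`setIntegral_pseudoDisc`). Integrating over the angle gives `2π δ_{m,k}`, and
`r = |ζ|²` turns the radial integral into the constant of the theorem, because a second
application of Chu–Vandermonde rewrites the Jacobi polynomial in powers of `-r` and `1 - r`, which
is the form the radial factor has (`jacobi_eq`, `pow_mul_zernike_sq`).
-/

noncomputable section

namespace WaveletOrth

/-! ### Binomial sums with Gamma weights -/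

theorem Gamma_add_nat_eq_ascPochhammer {y : ℝ} (hy : 0 < y) (n : ℕ) :
    Real.Gamma (y + n) = (ascPochhammer ℕ n).smeval y * Real.Gamma y := by
  induction n with
  | zero => simp
  | succ n ih =>
    have h : y + n ≠ 0 := by positivity
    push_cast
    rw [← add_assoc, Real.Gamma_add_one h, ih, ascPochhammer_succ_right, Polynomial.smeval_mul]
    simp [Polynomial.smeval_add, Polynomial.smeval_X, Polynomial.smeval_natCast]
    ring

/-- Generalized binomial coefficients as quotients of Gamma values. -/
theorem choose_eq_Gamma_div {y : ℝ} (hy : 0 < y) (n : ℕ) :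
    Ring.choose (y + n - 1) n = Real.Gamma (y + n) / (n.factorial * Real.Gamma y) := by
  have h := Ring.factorial_nsmul_multichoose_eq_ascPochhammer y n
  have hg := (Real.Gamma_pos_of_pos hy).ne'
  have hn : (n.factorial : ℝ) ≠ 0 := by positivity
  rw [← Ring.multichoose_eq, Gamma_add_nat_eq_ascPochhammer hy, ← h]
  field_simp
  rw [nsmul_eq_mul, mul_comm]

/-- The Chu–Vandermonde identity in Gamma form. -/
theorem Gamma_vandermonde {a : ℝ} (ha : 0 < a) (i j : ℕ) :
    Real.Gamma (a + i + j) = ∑ k ∈ Finset.range (j + 1),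
      (i.choose k * j.choose k * k.factorial : ℝ) *
        (Real.Gamma (a + i) * Real.Gamma (a + j) / Real.Gamma (a + k)) := by
  have h := Ring.add_choose_eq j (Commute.all (i : ℝ) (a + j - 1))
  rw [Finset.Nat.sum_antidiagonal_eq_sum_range_succ_mk] at h
  have hL : Ring.choose ((i : ℝ) + (a + j - 1)) j =
      Real.Gamma (a + i + j) / (j.factorial * Real.Gamma (a + i)) := by
    rw [← choose_eq_Gamma_div (by positivity)]
    congr 1
    ring
  have hgi : Real.Gamma (a + i) ≠ 0 := (Real.Gamma_pos_of_pos (by positivity)).ne'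
  have hj : (j.factorial : ℝ) ≠ 0 := by positivity
  rw [hL, div_eq_iff (by positivity)] at h
  rw [h, Finset.sum_mul]
  refine Finset.sum_congr rfl fun k hk => ?_
  have hkj : k ≤ j := Nat.lt_succ_iff.mp (Finset.mem_range.mp hk)
  have hR : Ring.choose (a + j - 1) (j - k) =
      Real.Gamma (a + j) / ((j - k).factorial * Real.Gamma (a + k)) := by
    have h1 := choose_eq_Gamma_div (y := a + k) (by positivity) (j - k)
    rw [Nat.cast_sub hkj, add_add_sub_cancel] at h1
    exact h1
  have hgk : Real.Gamma (a + k) ≠ 0 := (Real.Gamma_pos_of_pos (by positivity)).ne'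
  have hk' : ((j - k).factorial : ℝ) ≠ 0 := by positivity
  have hf : (j.choose k * k.factorial * (j - k).factorial : ℝ) = j.factorial := by
    exact_mod_cast Nat.choose_mul_factorial_mul_factorial hkj
  simp only [hR, Ring.choose_natCast, ← hf]
  field_simp

/-- The weight with which the `k`-th term enters the closed form of the wavelet transform and of
the Jacobi polynomial, with `a = α + 1`. It vanishes unless `k ≤ min m n`. -/
def coef (a : ℝ) (m n k : ℕ) : ℝ :=
  (m.choose k * n.choose k * k.factorial : ℝ) / Real.Gamma (a + k)

theorem coef_comm (a : ℝ) (m n k : ℕ) : coef a m n k = coef a n m k := by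
  unfold coef
  ring

theorem coef_eq_zero_left {a : ℝ} {m n k : ℕ} (h : m < k) : coef a m n k = 0 := by
  simp [coef, Nat.choose_eq_zero_of_lt h]

/-- A shifted form of the Chu–Vandermonde identity, used to expand the coefficients of the Jacobi
polynomials. -/
theorem Gamma_vandermonde_shift {a : ℝ} (ha : 0 < a) {q M t : ℕ} (hqM : q ≤ M) (htq : t ≤ q) :
    (M.factorial : ℝ) / (M - t).factorial * q.choose t * Real.Gamma (a + M + (q - t : ℕ)) =
      Real.Gamma (a + M) * Real.Gamma (a + q) *
        ∑ k ∈ Finset.range (q + 1), k.choose t * coef a M q k := by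
  have htM := htq.trans hqM
  have h := Gamma_vandermonde (a := a + t) (by positivity) (M - t) (q - t)
  have e1 : a + t + (M - t : ℕ) = a + M := by rw [Nat.cast_sub htM]; ring
  have e2 : a + t + (q - t : ℕ) = a + q := by rw [Nat.cast_sub htq]; ring
  rw [e1, e2] at h
  rw [h, show q + 1 = t + (q - t + 1) by omega, Finset.sum_range_add _ t,
    Finset.sum_eq_zero (s := Finset.range t), zero_add,
    Finset.mul_sum, Finset.mul_sum]
  · refine Finset.sum_congr rfl fun k hk => ?_
    have hk : k ≤ q - t := Nat.lt_succ_iff.mp (Finset.mem_range.mp hk)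
    have c1 : (M.choose (t + k) * (t + k).choose t : ℝ) = M.choose t * (M - t).choose k := by
      have := Nat.choose_mul (n := M) (k := t + k) (s := t) (by omega)
      rw [Nat.add_sub_cancel_left] at this
      exact_mod_cast this
    have c2 : (q.choose (t + k) * (t + k).choose t : ℝ) = q.choose t * (q - t).choose k := by
      have := Nat.choose_mul (n := q) (k := t + k) (s := t) (by omega)
      rw [Nat.add_sub_cancel_left] at this
      exact_mod_cast this
    have c3 : ((t + k).choose t * t.factorial * k.factorial : ℝ) = (t + k).factorial := by
      have := Nat.choose_mul_factorial_mul_factorial (Nat.le_add_right t k)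
      rw [Nat.add_sub_cancel_left] at this
      exact_mod_cast this
    have c4 : (M.choose t * t.factorial * (M - t).factorial : ℝ) = M.factorial := by
      exact_mod_cast Nat.choose_mul_factorial_mul_factorial htM
    have hf : ((M - t).factorial : ℝ) ≠ 0 := by positivity
    have hg : Real.Gamma (a + t + k) ≠ 0 := (Real.Gamma_pos_of_pos (by positivity)).ne'
    have key : (M.factorial : ℝ) / (M - t).factorial * q.choose t *
        ((M - t).choose k * (q - t).choose k * k.factorial) =
        (t + k).choose t * (M.choose (t + k) * q.choose (t + k) * (t + k).factorial) := by
      rw [← c4, ← c3]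
      field_simp
      linear_combination (-(q.choose (t + k) : ℝ) * (t + k).choose t) * c1
        - (M.choose t : ℝ) * (M - t).choose k * c2
    unfold coef
    rw [show a + ((t + k : ℕ) : ℝ) = a + t + k by push_cast; ring]
    linear_combination (Real.Gamma (a + M) * Real.Gamma (a + q) / Real.Gamma (a + t + k)) * key
  · intro k hk
    rw [Nat.choose_eq_zero_of_lt (Finset.mem_range.mp hk)]
    simp

theorem sum_choose_mul_choose_mul_pow {R : Type*} [CommRing R] (m k : ℕ) (x : R) :
    ∑ i ∈ Finset.range (m + 1), (m.choose i * i.choose k : R) * x ^ i =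
      m.choose k * x ^ k * (1 + x) ^ (m - k) := by
  rcases lt_or_ge m k with hmk | hkm
  · rw [Nat.choose_eq_zero_of_lt hmk, Finset.sum_eq_zero]
    · simp
    · intro i hi
      rw [Nat.choose_eq_zero_of_lt (n := i) (by have := Finset.mem_range.mp hi; omega)]
      simp
  · rw [show m + 1 = k + (m - k + 1) by omega, Finset.sum_range_add, Finset.sum_eq_zero, zero_add,
      add_comm 1 x, add_pow, Finset.mul_sum]
    · refine Finset.sum_congr rfl fun i hi => ?_
      have c1 : (m.choose (k + i) * (k + i).choose k : R) = m.choose k * (m - k).choose i := by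
        have := Nat.choose_mul (n := m) (k := k + i) (s := k) (by omega)
        rw [Nat.add_sub_cancel_left] at this
        simpa using congrArg (Nat.cast : ℕ → R) this
      rw [c1, pow_add, one_pow]
      ring
    · intro i hi
      rw [Nat.choose_eq_zero_of_lt (Finset.mem_range.mp hi)]
      simp

/-- The double sum produced by the Laplace transform of a product of two Laguerre polynomials
collapses to a single sum: the reduction of an Appell `F₂` function to a Gauss `₂F₁`. -/
theorem double_sum_Gamma_eq {a : ℝ} (ha : 0 < a) (m n : ℕ) (u v : ℂ) :
    ∑ i ∈ Finset.range (m + 1), ∑ j ∈ Finset.range (n + 1),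
      (m.choose i * n.choose j : ℂ) * (-u) ^ i * (-v) ^ j *
        ((Real.Gamma (a + i + j) / (Real.Gamma (a + i) * Real.Gamma (a + j)) : ℝ) : ℂ) =
    ∑ k ∈ Finset.range (n + 1), (coef a m n k : ℂ) * (u * v) ^ k * (1 - u) ^ (m - k) *
      (1 - v) ^ (n - k) := by
  have hG : ∀ x : ℕ, Real.Gamma (a + x) ≠ 0 := fun x =>
    (Real.Gamma_pos_of_pos (by positivity)).ne'
  have step : ∀ i ∈ Finset.range (m + 1), ∀ j ∈ Finset.range (n + 1),
      (m.choose i * n.choose j : ℂ) * (-u) ^ i * (-v) ^ j *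
        ((Real.Gamma (a + i + j) / (Real.Gamma (a + i) * Real.Gamma (a + j)) : ℝ) : ℂ) =
      ∑ k ∈ Finset.range (n + 1), ((k.factorial / Real.Gamma (a + k) : ℝ) : ℂ) *
        ((m.choose i * i.choose k : ℂ) * (-u) ^ i) *
        ((n.choose j * j.choose k : ℂ) * (-v) ^ j) := by
    intro i _ j hj
    have hjn : j + 1 ≤ n + 1 := Finset.mem_range.mp hj
    have e : Real.Gamma (a + i + j) / (Real.Gamma (a + i) * Real.Gamma (a + j)) =
        ∑ k ∈ Finset.range (n + 1),
          (k.factorial / Real.Gamma (a + k)) * (i.choose k * j.choose k : ℝ) := by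
      rw [Gamma_vandermonde ha, Finset.sum_div]
      rw [← Finset.sum_subset (Finset.range_subset_range.mpr hjn)]
      · refine Finset.sum_congr rfl fun k _ => ?_
        have := hG i
        have := hG j
        have := hG k
        field_simp
      · intro k _ hk
        rw [Nat.choose_eq_zero_of_lt (n := j) (by simpa using hk)]
        simp
    rw [e, Complex.ofReal_sum, Finset.mul_sum]
    refine Finset.sum_congr rfl fun k _ => ?_
    push_cast
    ring
  rw [Finset.sum_congr rfl fun i hi => Finset.sum_congr rfl (step i hi)]
  rw [Finset.sum_congr rfl fun i _ => Finset.sum_comm, Finset.sum_comm]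
  refine Finset.sum_congr rfl fun k _ => ?_
  simp_rw [← Finset.mul_sum]
  rw [← Finset.sum_mul, ← Finset.mul_sum, sum_choose_mul_choose_mul_pow,
    sum_choose_mul_choose_mul_pow]
  unfold coef
  push_cast
  have h : (-u) ^ k * (-v) ^ k = (u * v) ^ k := by rw [← mul_pow, neg_mul_neg]
  rw [← h, ← sub_eq_add_neg, ← sub_eq_add_neg]
  ring

/-! ### Laguerre, Jacobi and Zernike functions in closed form -/

/-- The Laguerre polynomial with Gamma values in place of generalized binomial coefficients. -/
theorem laguerre_eq {α : ℝ} (hα : 0 < α) (n : ℕ) (t : ℝ) :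
    laguerre n α t = Real.Gamma (n + α + 1) / n.factorial *
      ∑ i ∈ Finset.range (n + 1), n.choose i * (-t) ^ i / Real.Gamma (α + 1 + i) := by
  unfold laguerre
  rw [Finset.mul_sum]
  refine Finset.sum_congr rfl fun i hi => ?_
  have hin : i ≤ n := Nat.lt_succ_iff.mp (Finset.mem_range.mp hi)
  have h1 := choose_eq_Gamma_div (y := α + 1 + i) (by positivity) (n - i)
  rw [Nat.cast_sub hin, add_add_sub_cancel, show α + 1 + (n : ℝ) - 1 = n + α by ring,
    show α + 1 + (n : ℝ) = n + α + 1 by ring] at h1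
  have hf : (n.choose i * i.factorial * (n - i).factorial : ℝ) = n.factorial := by
    exact_mod_cast Nat.choose_mul_factorial_mul_factorial hin
  have hg : Real.Gamma (α + 1 + i) ≠ 0 := (Real.Gamma_pos_of_pos (by positivity)).ne'
  have hc : (n.choose i : ℝ) ≠ 0 := by exact_mod_cast (Nat.choose_pos hin).ne'
  rw [h1, ← hf, neg_pow t]
  field_simp

/-- The Jacobi polynomial in powers of `-r` and `1 - r`. -/
theorem jacobi_eq {α : ℝ} (hα : 0 < α) {q M : ℕ} (hqM : q ≤ M) (r : ℝ) :
    jacobi q ((M : ℝ) - q) α (1 - 2 * r) = Real.Gamma (q + α + 1) / q.factorial *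
      ∑ k ∈ Finset.range (q + 1), coef (α + 1) M q k * (-r) ^ (q - k) * (1 - r) ^ k := by
  have hgM : Real.Gamma (α + 1 + M) ≠ 0 := (Real.Gamma_pos_of_pos (by positivity)).ne'
  have hq : (q.factorial : ℝ) ≠ 0 := by positivity
  unfold jacobi
  -- After reversing the sum, each coefficient has the shape of `Gamma_vandermonde_shift`.
  rw [← Finset.sum_range_reflect]
  rw [show (q : ℝ) + (M - q) + 1 = M + 1 by ring, Real.Gamma_nat_eq_factorial,
    show (q : ℝ) + (M - q) + α + 1 = α + 1 + M by ring,
    show (1 - 2 * r - 1) / 2 = -r by ring]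
  have step : ∀ t ∈ Finset.range (q + 1),
      ((q.choose (q + 1 - 1 - t) : ℝ) * (Real.Gamma (q + (q + 1 - 1 - t : ℕ) + (M - q) + α + 1) /
        Real.Gamma ((q + 1 - 1 - t : ℕ) + ((M : ℝ) - q) + 1)) * (-r) ^ (q + 1 - 1 - t)) =
      ∑ k ∈ Finset.range (q + 1), Real.Gamma (α + 1 + M) * Real.Gamma (q + α + 1) / M.factorial *
        (coef (α + 1) M q k * (k.choose t * (-r) ^ (q - t))) := by
    intro t ht
    have htq : t ≤ q := Nat.lt_succ_iff.mp (Finset.mem_range.mp ht)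
    have h := Gamma_vandermonde_shift (a := α + 1) (by positivity) hqM htq
    have hM : (M.factorial : ℝ) ≠ 0 := by positivity
    have hMt : ((M - t).factorial : ℝ) ≠ 0 := by positivity
    rw [Nat.add_sub_cancel, Nat.choose_symm htq,
      show ((q - t : ℕ) : ℝ) + ((M : ℝ) - q) + 1 = ((M - t : ℕ) : ℝ) + 1 by
        rw [Nat.cast_sub htq, Nat.cast_sub (htq.trans hqM)]; ring, Real.Gamma_nat_eq_factorial,
      show (q : ℝ) + (q - t : ℕ) + (M - q) + α + 1 = α + 1 + M + (q - t : ℕ) by ring]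
    rw [← Finset.mul_sum]
    have e : ∑ k ∈ Finset.range (q + 1), coef (α + 1) M q k * (k.choose t * (-r) ^ (q - t)) =
        (-r) ^ (q - t) * ∑ k ∈ Finset.range (q + 1), k.choose t * coef (α + 1) M q k := by
      rw [Finset.mul_sum]
      exact Finset.sum_congr rfl fun k _ => by ring
    rw [e, show (q : ℝ) + α + 1 = α + 1 + q by ring]
    field_simp at h ⊢
    linear_combination (-r) ^ (q - t) * h
  rw [Finset.sum_congr rfl step, Finset.sum_comm]
  simp_rw [← Finset.mul_sum]
  rw [show ∀ S : ℝ, (M.factorial : ℝ) / (q.factorial * Real.Gamma (α + 1 + M)) *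
      (Real.Gamma (α + 1 + M) * Real.Gamma (q + α + 1) / M.factorial * S) =
      Real.Gamma (q + α + 1) / q.factorial * S from fun S => by
        have : (M.factorial : ℝ) ≠ 0 := by positivity
        field_simp]
  congr 1
  refine Finset.sum_congr rfl fun k hk => ?_
  have hkq : k ≤ q := Nat.lt_succ_iff.mp (Finset.mem_range.mp hk)
  rw [mul_assoc]
  congr 1
  rw [← Finset.sum_subset (Finset.range_subset_range.mpr (Nat.succ_le_succ hkq))]
  · rw [sub_eq_add_neg, add_pow, Finset.mul_sum]
    refine Finset.sum_congr rfl fun t ht => ?_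
    have htk : t ≤ k := Nat.lt_succ_iff.mp (Finset.mem_range.mp ht)
    rw [show q - t = (q - k) + (k - t) by omega, pow_add, one_pow]
    ring
  · intro t _ ht
    rw [Nat.choose_eq_zero_of_lt (by simpa using ht)]
    simp

/-- The radial profile of the wavelet transforms, as a function of `r = |ζ|²`. It is
`(-1)^q P_q^{(|m-n|,α)}(1-2r)` with `q = min m n`, up to a constant, and a polynomial in `r`. -/
def radial (α : ℝ) (m n : ℕ) (r : ℝ) : ℝ :=
  ∑ k ∈ Finset.range (min m n + 1), coef (α + 1) m n k * (-(1 - r)) ^ k * r ^ (min m n - k)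

theorem coef_max_min (a : ℝ) (m n k : ℕ) : coef a (max m n) (min m n) k = coef a m n k := by
  rcases le_total m n with h | h
  · rw [max_eq_right h, min_eq_left h, coef_comm]
  · rw [max_eq_left h, min_eq_right h]

theorem abs_sub_eq_max_sub_min (m n : ℕ) :
    |(m : ℝ) - n| = ((max m n : ℕ) : ℝ) - ((min m n : ℕ) : ℝ) := by
  rcases le_total m n with h | h
  · rw [max_eq_right h, min_eq_left h, abs_sub_comm, abs_of_nonneg]
    simpa using h
  · rw [max_eq_left h, min_eq_right h, abs_of_nonneg]
    simpa using h

theorem jacobi_min_eq_radial {α : ℝ} (hα : 0 < α) (m n : ℕ) (r : ℝ) :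
    jacobi (min m n) |(m : ℝ) - n| α (1 - 2 * r) =
      Real.Gamma ((min m n : ℕ) + α + 1) / (min m n).factorial *
        ((-1) ^ min m n * radial α m n r) := by
  rw [abs_sub_eq_max_sub_min, jacobi_eq hα (min_le_max)]
  congr 1
  unfold radial
  rw [Finset.mul_sum]
  refine Finset.sum_congr rfl fun k hk => ?_
  have hk : k ≤ min m n := Nat.lt_succ_iff.mp (Finset.mem_range.mp hk)
  rw [coef_max_min, neg_pow r, neg_pow (1 - r)]
  have : (-1 : ℝ) ^ min m n = (-1) ^ (min m n - k) * (-1) ^ k := by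
    rw [← pow_add, Nat.sub_add_cancel hk]
  rw [this]
  have h2 : ((-1 : ℝ) ^ k) * (-1) ^ k = 1 := by rw [← mul_pow]; simp
  linear_combination
    (-coef (α + 1) m n k * (-1) ^ (min m n - k) * r ^ (min m n - k) * (1 - r) ^ k) * h2

/-- Away from `r = 0` the integrand of `localConst` is a polynomial times `(1-r)^{α-1}`. -/
theorem pow_mul_zernike_sq {α : ℝ} (hα : 0 < α) (m n : ℕ) {r : ℝ} (hr : r ≠ 0) :
    r ^ (m + n) * zernike α m n r ^ 2 =
      Real.Gamma (m + α + 1) * Real.Gamma (n + α + 1) / (m.factorial * n.factorial) *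
        (r ^ (max m n - min m n) * radial α m n r ^ 2) := by
  have hGp : ∀ x : ℕ, 0 < Real.Gamma (x + α + 1) := fun x => Real.Gamma_pos_of_pos (by positivity)
  have hG := fun x => (hGp x).ne'
  have hsymm : Real.Gamma (m + α + 1) * Real.Gamma (n + α + 1) / (m.factorial * n.factorial) =
      Real.Gamma ((max m n : ℕ) + α + 1) * Real.Gamma ((min m n : ℕ) + α + 1) /
        ((max m n).factorial * (min m n).factorial) := by
    rcases le_total m n with h | h
    · rw [max_eq_right h, min_eq_left h, mul_comm, mul_comm (m.factorial : ℝ)]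
    · rw [max_eq_left h, min_eq_right h]
  have hmn : m + n = (max m n - min m n) + 2 * min m n := by
    rcases le_total m n with h | h
    · rw [max_eq_right h, min_eq_left h]; omega
    · rw [max_eq_left h, min_eq_right h]; omega
  unfold zernike
  rw [jacobi_min_eq_radial hα, hsymm, hmn]
  generalize min m n = q
  generalize max m n = M
  have hM := hGp M
  have hq := hGp q
  rw [mul_pow, mul_pow, Real.sq_sqrt (by positivity), zpow_neg, zpow_natCast, neg_pow r q]
  have hs : (((-1 : ℝ) ^ q) ^ 2) = 1 := by rw [← pow_mul, mul_comm, pow_mul]; simp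
  have hrq : r ^ q ≠ 0 := pow_ne_zero _ hr
  have hs0 : ((-1 : ℝ) ^ q) ≠ 0 := by simp
  rw [pow_add, mul_comm 2 q, pow_mul]
  have hM' := hM.ne'
  have hq' := hq.ne'
  field_simp

theorem pow_mul_zernike_self_sq {α : ℝ} (hα : 0 < α) (n : ℕ) {r : ℝ} (hr : r ≠ 0) :
    r ^ (n + n) * zernike α n n r ^ 2 = jacobi n 0 α (1 - 2 * r) ^ 2 := by
  have h := jacobi_min_eq_radial hα n n r
  simp only [min_self, sub_self, abs_zero] at h
  rw [pow_mul_zernike_sq hα n n hr, h]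
  have hs : (((-1 : ℝ) ^ n) ^ 2) = 1 := by rw [← pow_mul, mul_comm, pow_mul]; simp
  simp only [mul_pow, hs, div_pow, max_self, min_self, Nat.sub_self, pow_zero]
  ring

/-! ### The Laplace transform of a power -/

theorem integrableOn_rpow_mul_exp_neg {a r : ℝ} (ha : 0 < a) (hr : 0 < r) :
    IntegrableOn (fun t : ℝ => t ^ (a - 1) * Real.exp (-(r * t))) (Ioi 0) := by
  have h := integrableOn_rpow_mul_exp_neg_mul_rpow (p := 1) (s := a - 1) (b := r)
    (by linarith) one_pos hr
  simpa using h

theorem integrableOn_rpow_mul_cexp_neg {a : ℝ} (ha : 0 < a) {p : ℂ} (hp : 0 < p.re) :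
    IntegrableOn (fun t : ℝ => ((t ^ (a - 1) : ℝ) : ℂ) * Complex.exp (-(p * t))) (Ioi 0) := by
  refine (integrableOn_rpow_mul_exp_neg ha hp).mono' (by fun_prop) ?_
  filter_upwards [ae_restrict_mem measurableSet_Ioi] with t ht
  rw [norm_mul, Complex.norm_real, Complex.norm_exp, Real.norm_of_nonneg
    (Real.rpow_nonneg (le_of_lt ht) _)]
  simp

open ProbabilityTheory in
/-- `∫₀^∞ t^{a-1} e^{-pt} dt = p^{-a} Γ(a)` on the right half-plane. Both sides are holomorphic in
`p`, the left one as a moment generating function, and they agree for `p > 0`. -/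
theorem integral_rpow_mul_cexp_neg {a : ℝ} (ha : 0 < a) {p : ℂ} (hp : 0 < p.re) :
    ∫ t in Ioi (0 : ℝ), ((t ^ (a - 1) : ℝ) : ℂ) * Complex.exp (-(p * t)) =
      p ^ (-(a : ℂ)) * (Real.Gamma a : ℂ) := by
  set μ : Measure ℝ := (volume.restrict (Ioi (0 : ℝ))).withDensity
    fun t => ENNReal.ofReal (t ^ (a - 1)) with hμ
  have hmeas : Measurable fun t : ℝ => ENNReal.ofReal (t ^ (a - 1)) := by fun_prop
  have hfin : ∀ᵐ t ∂(volume.restrict (Ioi (0 : ℝ))), ENNReal.ofReal (t ^ (a - 1)) < ⊤ :=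
    Filter.Eventually.of_forall fun t => ENNReal.ofReal_lt_top
  have hset : Iio (0 : ℝ) ⊆ integrableExpSet id μ := by
    intro x hx
    have hx' : 0 < -x := neg_pos.mpr hx
    change Integrable (fun t => Real.exp (x * id t)) μ
    rw [hμ, integrable_withDensity_iff_integrable_smul' hmeas hfin]
    refine (integrableOn_rpow_mul_exp_neg ha hx').congr ?_
    filter_upwards [ae_restrict_mem measurableSet_Ioi] with t ht
    rw [ENNReal.toReal_ofReal (Real.rpow_nonneg (le_of_lt ht) _), smul_eq_mul]
    simp
  have hmgf : ∀ z : ℂ, complexMGF id μ z =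
      ∫ t in Ioi (0 : ℝ), ((t ^ (a - 1) : ℝ) : ℂ) * Complex.exp (z * t) := by
    intro z
    rw [complexMGF, hμ, integral_withDensity_eq_integral_toReal_smul hmeas hfin]
    refine setIntegral_congr_fun measurableSet_Ioi fun t ht => ?_
    simp only [ENNReal.toReal_ofReal (Real.rpow_nonneg (le_of_lt (mem_Ioi.mp ht)) _), id,
      Complex.real_smul]
  set U : Set ℂ := {z | z.re < 0} with hU
  have hUo : IsOpen U := isOpen_lt Complex.continuous_re continuous_const
  have hUc : IsPreconnected U := (convex_halfSpace_re_lt 0).isPreconnected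
  have hf : AnalyticOnNhd ℂ (complexMGF id μ) U := by
    refine analyticOnNhd_complexMGF.mono fun z hz => ?_
    exact interior_maximal hset isOpen_Iio hz
  have hg : AnalyticOnNhd ℂ (fun z : ℂ => (-z) ^ (-(a : ℂ)) * (Real.Gamma a : ℂ)) U := by
    refine DifferentiableOn.analyticOnNhd (fun z hz => ?_) hUo
    have hz' : -z ∈ Complex.slitPlane := Or.inl (by simpa [hU] using hz)
    exact ((differentiableAt_id.neg.cpow_const hz').mul_const _).differentiableWithinAt
  have hreal : ∀ x : ℝ, x < 0 →
      complexMGF id μ x = (-(x : ℂ)) ^ (-(a : ℂ)) * (Real.Gamma a : ℂ) := by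
    intro x hx
    have hx' : 0 < -x := neg_pos.mpr hx
    have h := Real.integral_rpow_mul_exp_neg_mul_Ioi ha hx'
    rw [hmgf]
    rw [← Complex.ofReal_neg, ← Complex.ofReal_neg, ← Complex.ofReal_cpow hx'.le,
      ← Complex.ofReal_mul, Real.rpow_neg hx'.le, ← Real.inv_rpow hx'.le, ← one_div, ← h,
      ← integral_complex_ofReal]
    congr 1
    funext t
    push_cast
    simp
  have hfreq : ∃ᶠ z in nhdsWithin (-1 : ℂ) {-1}ᶜ,
      complexMGF id μ z = (-z) ^ (-(a : ℂ)) * (Real.Gamma a : ℂ) := by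
    have ht : Filter.Tendsto (fun x : ℝ => (x : ℂ)) (nhdsWithin (-1) {-1}ᶜ)
        (nhdsWithin (-1) {-1}ᶜ) := by
      refine tendsto_nhdsWithin_iff.mpr ⟨?_, ?_⟩
      · have := (Complex.continuous_ofReal.tendsto (-1)).mono_left
          (nhdsWithin_le_nhds (s := {(-1 : ℝ)}ᶜ))
        simpa using this
      · filter_upwards [self_mem_nhdsWithin] with x hx
        simp only [mem_compl_iff, mem_singleton_iff] at hx ⊢
        exact_mod_cast hx
    refine ht.frequently (Filter.Eventually.frequently ?_)
    have : ∀ᶠ x : ℝ in nhdsWithin (-1) {-1}ᶜ, x < 0 :=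
      nhdsWithin_le_nhds (Iio_mem_nhds (by norm_num))
    filter_upwards [this] with x hx using hreal x hx
  have key := hf.eqOn_of_preconnected_of_frequently_eq hg hUc
    (show (-1 : ℂ) ∈ U by simp [hU]) hfreq
  have h := key (show -p ∈ U by simpa [hU] using hp)
  rw [hmgf] at h
  simpa using h

/-! ### The wavelet transform on the Fourier side -/

/-- On `L¹ ∩ L²` the inverse Fourier transform of `L²` is given by the integral. Both sides define
the same tempered distribution. -/
theorem fourierInv_toLp_ae_eq {g : ℝ → ℂ} (hg1 : Integrable g) (hg2 : MemLp g 2) :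
    (𝓕⁻ hg2.toLp : Lp ℂ 2 (volume : Measure ℝ)) =ᵐ[volume] 𝓕⁻ g := by
  have hcont : Continuous (𝓕⁻ g) := VectorFourier.fourierIntegral_continuous
    Real.continuous_fourierChar (L := -innerₗ ℝ)
    ((continuous_snd.mul continuous_fst).neg : Continuous fun p : ℝ × ℝ => -(p.2 * p.1)) hg1
  refine ae_eq_of_integral_contDiff_smul_eq
    ((Lp.memLp _).locallyIntegrable one_le_two) hcont.locallyIntegrable fun φ hφ hφc => ?_
  have h1 : HasCompactSupport (Complex.ofRealCLM ∘ φ) := hφc.comp_left rfl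
  have h2 : ContDiff ℝ ((⊤ : ℕ∞) : WithTop ℕ∞) (Complex.ofRealCLM ∘ φ) := by fun_prop
  set Φ := h1.toSchwartzMap h2 with hΦ
  have hΦφ : ∀ t, Φ t = (φ t : ℂ) := fun t => rfl
  have e1 : ∫ t, φ t • (𝓕⁻ hg2.toLp : Lp ℂ 2 (volume : Measure ℝ)) t =
      Lp.toTemperedDistribution (𝓕⁻ hg2.toLp : Lp ℂ 2 (volume : Measure ℝ)) Φ := by
    rw [Lp.toTemperedDistribution_apply]
    simp only [hΦφ, smul_eq_mul, Complex.real_smul]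
  rw [e1, ← Lp.fourierInv_toTemperedDistribution_eq, TemperedDistribution.fourierInv_apply,
    Lp.toTemperedDistribution_apply]
  have e2 : ∫ t, (𝓕⁻ Φ) t • (hg2.toLp : ℝ → ℂ) t = ∫ t, (𝓕⁻ (Φ : ℝ → ℂ)) t • g t := by
    refine integral_congr_ae ?_
    filter_upwards [hg2.coeFn_toLp] with t ht
    rw [ht, SchwartzMap.fourierInv_coe]
  rw [e2]
  have flip := VectorFourier.integral_fourierIntegral_smul_eq_flip (μ := (volume : Measure ℝ))
    (ν := (volume : Measure ℝ)) (L := -innerₗ ℝ) (f := (Φ : ℝ → ℂ)) (g := g)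
    Real.continuous_fourierChar
    ((continuous_snd.mul continuous_fst).neg : Continuous fun p : ℝ × ℝ => -(p.2 * p.1))
    Φ.integrable hg1
  refine flip.trans ?_
  have hsymm : (-innerₗ ℝ : ℝ →ₗ[ℝ] ℝ →ₗ[ℝ] ℝ).flip = -innerₗ ℝ := by
    ext
    simp
  rw [hsymm]
  refine integral_congr_ae (Filter.Eventually.of_forall fun t => ?_)
  simp only [hΦφ, smul_eq_mul, Complex.real_smul]
  rfl

/-- The Fourier side of `affineAction`: a dilation followed by a modulation. -/
def affineHat (z : ℍ) (g : ℝ → ℂ) (η : ℝ) : ℂ :=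
  (Real.sqrt z.im : ℂ) * Complex.exp (-(2 * Real.pi * η * z.re * Complex.I)) * g (z.im * η)

theorem memLp_affineHat (z : ℍ) {g : ℝ → ℂ} (hgm : Measurable g) (hg2 : MemLp g 2) :
    MemLp (affineHat z g) 2 := by
  have hm : Measurable (affineHat z g) := by
    unfold affineHat
    fun_prop
  rw [memLp_two_iff_integrable_sq_norm hgm.aestronglyMeasurable] at hg2
  rw [memLp_two_iff_integrable_sq_norm hm.aestronglyMeasurable]
  refine ((hg2.comp_mul_left' z.im_pos.ne').const_mul (‖(Real.sqrt z.im : ℂ)‖ ^ 2)).congr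
    (Filter.Eventually.of_forall fun η => ?_)
  simp only [affineHat, norm_mul, mul_pow, Complex.norm_exp]
  simp

theorem integrable_affineHat (z : ℍ) {g : ℝ → ℂ} (hgm : Measurable g) (hg1 : Integrable g) :
    Integrable (affineHat z g) := by
  have hm : Measurable (affineHat z g) := by
    unfold affineHat
    fun_prop
  rw [← integrable_norm_iff hm.aestronglyMeasurable]
  refine ((hg1.norm.comp_mul_left' z.im_pos.ne').const_mul (‖(Real.sqrt z.im : ℂ)‖)).congr
    (Filter.Eventually.of_forall fun η => ?_)
  simp only [affineHat, norm_mul, Complex.norm_exp]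
  simp

/-- The inverse Fourier integral intertwines `affineHat` and `affineAction`, by the substitution
`v = s η`. -/
theorem affineAction_fourierInv (z : ℍ) (g : ℝ → ℂ) (t : ℝ) :
    affineAction z (𝓕⁻ g) t = (𝓕⁻ (affineHat z g) : ℝ → ℂ) t := by
  have hs := z.im_pos
  rw [affineAction, Real.fourierInv_eq', Real.fourierInv_eq']
  have h := Measure.integral_comp_mul_left (fun v : ℝ =>
    Complex.exp ((2 * Real.pi * (v * ((t - z.re) / z.im)) : ℝ) * Complex.I) • g v) z.im
  have h' : (∫ v : ℝ, Complex.exp ((2 * Real.pi * inner ℝ v ((t - z.re) / z.im) : ℝ) *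
      Complex.I) • g v) = z.im • ∫ x : ℝ, Complex.exp ((2 * Real.pi * (z.im * x *
        ((t - z.re) / z.im)) : ℝ) * Complex.I) • g (z.im * x) := by
    rw [h, abs_of_pos (inv_pos.mpr hs), smul_smul, mul_inv_cancel₀ hs.ne', one_smul]
    simp only [RCLike.inner_apply, conj_trivial, mul_comm]
  rw [h', Complex.real_smul, ← mul_assoc]
  have hsq : ((1 / Real.sqrt z.im : ℝ) : ℂ) * (z.im : ℂ) = (Real.sqrt z.im : ℂ) := by
    rw [← Complex.ofReal_mul, one_div, inv_mul_eq_div, Real.div_sqrt]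
  rw [hsq, ← integral_const_mul]
  refine integral_congr_ae (Filter.Eventually.of_forall fun η => ?_)
  simp only [affineHat, smul_eq_mul]
  rw [show Complex.exp ((2 * Real.pi * (z.im * η * ((t - z.re) / z.im)) : ℝ) * Complex.I) =
    Complex.exp ((2 * Real.pi * inner ℝ η t : ℝ) * Complex.I) *
      Complex.exp (-(2 * Real.pi * η * z.re * Complex.I)) by
    rw [← Complex.exp_add]
    congr 1
    simp only [RCLike.inner_apply, conj_trivial]
    push_cast
    have : (z.im : ℂ) ≠ 0 := by exact_mod_cast hs.ne'
    field_simp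
    ring]
  ring

theorem ae_affine {p : ℝ → Prop} (z : ℍ) (h : ∀ᵐ t, p t) :
    ∀ᵐ t : ℝ, p ((t - z.re) / z.im) := by
  have hne : z.im⁻¹ ≠ 0 := inv_ne_zero z.im_pos.ne'
  have hq : Measure.QuasiMeasurePreserving (fun t : ℝ => t * z.im⁻¹) volume volume := by
    refine ⟨by fun_prop, ?_⟩
    rw [Real.map_volume_mul_right hne]
    exact Measure.smul_absolutelyContinuous
  have h2 := (measurePreserving_sub_right (volume : Measure ℝ) z.re).quasiMeasurePreserving.ae
    (hq.ae h)
  simpa [div_eq_mul_inv] using h2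

/-- Plancherel's formula for the wavelet transform. -/
theorem integral_mul_conj_affineAction (z : ℍ) {g f : ℝ → ℂ} (hgm : Measurable g)
    (hg1 : Integrable g) (hg2 : MemLp g 2) (hf2 : MemLp f 2) :
    ∫ t : ℝ, (𝓕⁻ hf2.toLp : Lp ℂ 2 (volume : Measure ℝ)) t *
      conj (affineAction z (𝓕⁻ hg2.toLp : Lp ℂ 2 (volume : Measure ℝ)) t) =
    ∫ η : ℝ, f η * conj (affineHat z g η) := by
  have hz2 := memLp_affineHat z hgm hg2
  have hae : affineAction z (𝓕⁻ hg2.toLp : Lp ℂ 2 (volume : Measure ℝ)) =ᵐ[volume]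
      (𝓕⁻ hz2.toLp : Lp ℂ 2 (volume : Measure ℝ)) := by
    filter_upwards [ae_affine z (fourierInv_toLp_ae_eq hg1 hg2),
      fourierInv_toLp_ae_eq (integrable_affineHat z hgm hg1) hz2] with t h1 h2
    rw [h2, ← affineAction_fourierInv, affineAction, affineAction, h1]
  have e1 : ∫ t : ℝ, (𝓕⁻ hf2.toLp : Lp ℂ 2 (volume : Measure ℝ)) t *
      conj (affineAction z (𝓕⁻ hg2.toLp : Lp ℂ 2 (volume : Measure ℝ)) t) =
      inner ℂ (𝓕⁻ hz2.toLp : Lp ℂ 2 (volume : Measure ℝ)) (𝓕⁻ hf2.toLp) := by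
    rw [L2.inner_def]
    refine integral_congr_ae ?_
    filter_upwards [hae] with t ht
    rw [ht, RCLike.inner_apply]
  rw [e1, ← Lp.inner_fourier_eq, FourierTransform.fourier_fourierInv_eq,
    FourierTransform.fourier_fourierInv_eq, L2.inner_def]
  refine integral_congr_ae ?_
  filter_upwards [hz2.coeFn_toLp, hf2.coeFn_toLp] with η h1 h2
  rw [h1, h2, RCLike.inner_apply]

/-! ### Explicit evaluation of the wavelet transforms -/

/-- The normalizing factor of `psiHat`. -/
def normConst (α : ℝ) (n : ℕ) : ℝ :=
  Real.sqrt ((2 : ℝ) ^ (α + 2) * Real.pi * n.factorial / Real.Gamma (n + α + 1))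

theorem psiHat_of_pos {α : ℝ} (hα : 0 < α) (n : ℕ) {t : ℝ} (ht : 0 < t) :
    psiHat α n t = ∑ i ∈ Finset.range (n + 1),
      ((normConst α n * (Real.Gamma (n + α + 1) / n.factorial) * (n.choose i * (-2) ^ i /
        Real.Gamma (α + 1 + i)) * (t ^ (α / 2) * t ^ i * Real.exp (-t)) : ℝ) : ℂ) := by
  rw [psiHat, indicator_of_mem (mem_Ioi.mpr ht), laguerre_eq hα, ← Complex.ofReal_sum,
    Finset.mul_sum, Finset.mul_sum]
  congr 1
  refine Finset.sum_congr rfl fun i _ => ?_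
  rw [normConst, show -(2 * t) = (-2) * t by ring, mul_pow]
  ring

theorem integrable_psiHat {α : ℝ} (hα : 0 < α) (n : ℕ) : Integrable (psiHat α n) := by
  have hsum : IntegrableOn (fun t => ∑ i ∈ Finset.range (n + 1),
      ((normConst α n * (Real.Gamma (n + α + 1) / n.factorial) * (n.choose i * (-2) ^ i /
        Real.Gamma (α + 1 + i)) * (t ^ (α / 2) * t ^ i * Real.exp (-t)) : ℝ) : ℂ)) (Ioi 0) := by
    refine integrable_finsetSum _ fun i _ => Integrable.ofReal (Integrable.const_mul ?_ _)
    refine (integrableOn_rpow_mul_exp_neg (a := α / 2 + i + 1) (by positivity)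
      one_pos).congr_fun (fun t ht => ?_) measurableSet_Ioi
    simp only
    rw [add_sub_cancel_right, Real.rpow_add ht, Real.rpow_natCast, one_mul]
  have h := hsum.congr_fun (fun t ht => (psiHat_of_pos hα n (mem_Ioi.mp ht)).symm)
    measurableSet_Ioi
  rw [← integrable_indicator_iff measurableSet_Ioi] at h
  refine h.congr (Filter.Eventually.of_forall fun t => ?_)
  simp only [psiHat, indicator_indicator, inter_self]

theorem psiHat_of_nonpos (α : ℝ) (n : ℕ) {t : ℝ} (ht : t ≤ 0) : psiHat α n t = 0 :=
  indicator_of_notMem (by simpa using ht) _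

theorem conj_psiHat (α : ℝ) (n : ℕ) (t : ℝ) : conj (psiHat α n t) = psiHat α n t := by
  rcases le_or_gt t 0 with h | h
  · rw [psiHat_of_nonpos α n h, map_zero]
  · rw [psiHat, indicator_of_mem (mem_Ioi.mpr h), Complex.conj_ofReal]

/-- The wavelet transform as an integral over the positive frequencies. -/
theorem waveletTransform_psi_eq_integral {α : ℝ} (hα : 0 < α) (n m : ℕ) (z : ℍ) :
    waveletTransform (psi α hα n) (psi α hα m) z =
      (2 * Real.pi : ℂ)⁻¹ * (Real.sqrt z.im * ∫ ξ in Ioi (0 : ℝ),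
        psiHat α m ξ * psiHat α n (z.im * ξ) * Complex.exp (ξ * z.re * Complex.I)) := by
  have hpi : (0 : ℝ) < 2 * Real.pi := by positivity
  have hm : Measurable fun ξ : ℝ => psiHat α n (2 * Real.pi * ξ) :=
    (measurable_psiHat α n).comp (measurable_const_mul _)
  have h := integral_mul_conj_affineAction z hm
    ((integrable_psiHat hα n).comp_mul_left' hpi.ne') (memLp_psiHat_rescale hα n)
    (memLp_psiHat_rescale hα m)
  refine h.trans ?_
  have h2 := Measure.integral_comp_mul_left (fun ξ : ℝ => (Real.sqrt z.im : ℂ) *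
    (psiHat α m ξ * psiHat α n (z.im * ξ) * Complex.exp (ξ * z.re * Complex.I))) (2 * Real.pi)
  rw [abs_of_pos (inv_pos.mpr hpi), Complex.real_smul] at h2
  rw [setIntegral_eq_integral_of_forall_compl_eq_zero]
  · rw [← integral_const_mul]
    push_cast at h2 ⊢
    rw [← h2]
    refine integral_congr_ae (Filter.Eventually.of_forall fun η => ?_)
    simp only [affineHat, map_mul, conj_psiHat, Complex.conj_ofReal, ← Complex.exp_conj, map_neg,
      Complex.conj_I, map_ofNat]
    rw [show 2 * Real.pi * (z.im * η) = z.im * (2 * Real.pi * η) by ring]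
    ring_nf
  · intro ξ hξ
    rw [psiHat_of_nonpos α m (by simpa using hξ)]
    simp

/-- The amplitude of the wavelet transforms. -/
def ampl (α : ℝ) (m n : ℕ) : ℝ :=
  normConst α m * normConst α n * (Real.Gamma (m + α + 1) * Real.Gamma (n + α + 1)) /
    (2 * Real.pi * (m.factorial * n.factorial))

/-- The coefficient of `ξ^{α+i+j}` coming from the `i`-th and `j`-th Laguerre terms in the product
`psiHat α m ξ * psiHat α n (s ξ)`. -/
def laguerreCoef (α s : ℝ) (m n i j : ℕ) : ℝ :=
  normConst α m * normConst α n * (Real.Gamma (m + α + 1) / m.factorial) *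
    (Real.Gamma (n + α + 1) / n.factorial) * s ^ (α / 2) *
    (m.choose i * (-2) ^ i / Real.Gamma (α + 1 + i)) *
    (n.choose j * (-2 * s) ^ j / Real.Gamma (α + 1 + j))

/-- The integrand is a combination of the functions `ξ^{α+i+j} e^{-pξ}`, whose Laplace integrals
are Gamma values. -/
theorem psiHat_mul_psiHat {α : ℝ} (hα : 0 < α) (m n : ℕ) {s x ξ : ℝ} (hs : 0 < s) (hξ : 0 < ξ)
    {p : ℂ} (hp : p = 1 + s - x * Complex.I) :
    psiHat α m ξ * psiHat α n (s * ξ) * Complex.exp (ξ * x * Complex.I) =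
      ∑ i ∈ Finset.range (m + 1), ∑ j ∈ Finset.range (n + 1), (laguerreCoef α s m n i j : ℂ) *
        (((ξ ^ (α + 1 + i + j - 1) : ℝ) : ℂ) * Complex.exp (-(p * ξ))) := by
  rw [psiHat_of_pos hα m hξ, psiHat_of_pos hα n (mul_pos hs hξ), Finset.sum_mul_sum,
    Finset.sum_mul]
  refine Finset.sum_congr rfl fun i _ => ?_
  rw [Finset.sum_mul]
  refine Finset.sum_congr rfl fun j _ => ?_
  have e1 : ξ ^ (α + 1 + i + j - 1) = ξ ^ (α / 2) * ξ ^ (α / 2) * ξ ^ i * ξ ^ j := by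
    rw [← Real.rpow_add hξ, ← Real.rpow_natCast ξ i, ← Real.rpow_natCast ξ j, ← Real.rpow_add hξ,
      ← Real.rpow_add hξ]
    congr 1
    ring
  have e2 : Complex.exp (-(p * ξ)) = ((Real.exp (-ξ) * Real.exp (-(s * ξ)) : ℝ) : ℂ) *
      Complex.exp (ξ * x * Complex.I) := by
    rw [← Real.exp_add, Complex.ofReal_exp, ← Complex.exp_add, hp]
    congr 1
    push_cast
    ring
  rw [e1, e2, Real.mul_rpow hs.le hξ.le, mul_pow, laguerreCoef, mul_pow]
  generalize Complex.exp (ξ * x * Complex.I) = E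
  push_cast
  simp only [div_eq_mul_inv]
  ring

theorem integral_psiHat_mul_psiHat {α : ℝ} (hα : 0 < α) (m n : ℕ) {s x : ℝ} (hs : 0 < s)
    {p : ℂ} (hp : p = 1 + s - x * Complex.I) :
    ∫ ξ in Ioi (0 : ℝ), psiHat α m ξ * psiHat α n (s * ξ) * Complex.exp (ξ * x * Complex.I) =
      ∑ i ∈ Finset.range (m + 1), ∑ j ∈ Finset.range (n + 1), (laguerreCoef α s m n i j : ℂ) *
        (p ^ (-((α + 1 + i + j : ℝ) : ℂ)) * (Real.Gamma (α + 1 + i + j) : ℂ)) := by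
  have hpre : 0 < p.re := by
    rw [hp]
    simp
    linarith
  rw [setIntegral_congr_fun measurableSet_Ioi
    fun ξ (hξ : 0 < ξ) => psiHat_mul_psiHat hα m n hs hξ hp]
  have hi : ∀ i j : ℕ, IntegrableOn (fun ξ : ℝ => (laguerreCoef α s m n i j : ℂ) *
      (((ξ ^ (α + 1 + i + j - 1) : ℝ) : ℂ) * Complex.exp (-(p * ξ)))) (Ioi 0) := fun i j =>
    (integrableOn_rpow_mul_cexp_neg (by positivity) hpre).const_mul _
  rw [integral_finsetSum _ fun i _ => integrable_finsetSum _ fun j _ => hi i j]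
  refine Finset.sum_congr rfl fun i _ => ?_
  rw [integral_finsetSum _ fun j _ => hi i j]
  refine Finset.sum_congr rfl fun j _ => ?_
  rw [integral_const_mul, integral_rpow_mul_cexp_neg (by positivity) hpre]

/-- The wavelet transform in closed form. Here `p = (z + i)/i`, so that `Re p = 1 + Im z > 0` and
the power of `p` is on the principal branch. -/
theorem waveletTransform_psi {α : ℝ} (hα : 0 < α) (n m : ℕ) (z : ℍ) {p : ℂ}
    (hp : p = 1 + z.im - z.re * Complex.I) :
    waveletTransform (psi α hα n) (psi α hα m) z =
      (ampl α m n : ℂ) * ((z.im ^ ((α + 1) / 2) : ℝ) : ℂ) * p ^ (-((α + 1 : ℝ) : ℂ)) *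
      ∑ k ∈ Finset.range (n + 1), (coef (α + 1) m n k : ℂ) * (2 / p * (2 * z.im / p)) ^ k *
        (1 - 2 / p) ^ (m - k) * (1 - 2 * z.im / p) ^ (n - k) := by
  have hs := z.im_pos
  have hp0 : p ≠ 0 := by
    rintro rfl
    have := congrArg Complex.re hp
    simp at this
    linarith
  rw [waveletTransform_psi_eq_integral, ← double_sum_Gamma_eq (by positivity),
    integral_psiHat_mul_psiHat hα m n hs hp]
  rw [Finset.mul_sum, Finset.mul_sum, Finset.mul_sum]
  refine Finset.sum_congr rfl fun i _ => ?_
  rw [Finset.mul_sum, Finset.mul_sum, Finset.mul_sum]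
  refine Finset.sum_congr rfl fun j _ => ?_
  have e3 : p ^ (-((α + 1 + i + j : ℝ) : ℂ)) =
      p ^ (-((α + 1 : ℝ) : ℂ)) * ((p⁻¹) ^ i * (p⁻¹) ^ j) := by
    rw [inv_pow, inv_pow, ← Complex.cpow_natCast, ← Complex.cpow_natCast, ← Complex.cpow_neg,
      ← Complex.cpow_neg, ← Complex.cpow_add _ _ hp0, ← Complex.cpow_add _ _ hp0]
    congr 1
    push_cast
    ring
  have e4 : z.im ^ ((α + 1) / 2) = Real.sqrt z.im * z.im ^ (α / 2) := by
    rw [Real.sqrt_eq_rpow, ← Real.rpow_add hs]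
    congr 1
    ring
  have e5 : (-(2 / p)) ^ i = (-2) ^ i * (p⁻¹) ^ i := by rw [← mul_pow]; ring
  have e6 : (-(2 * (z.im : ℂ) / p)) ^ j = (-2 * (z.im : ℂ)) ^ j * (p⁻¹) ^ j := by
    rw [← mul_pow]; ring
  rw [e3, e4, e5, e6, ampl, laguerreCoef]
  generalize p ^ (-((α + 1 : ℝ) : ℂ)) = Q
  push_cast
  simp only [div_eq_mul_inv, mul_inv]
  ring

/-! ### The invariant measure in the disc model -/

/-- The density of the invariant measure with respect to Lebesgue measure. -/
def hypDensity (z : ℍ) : NNReal := (1 / NNReal.mk z.im z.im_pos.le) ^ 2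

theorem coe_hypDensity (z : ℍ) : (hypDensity z : ℝ) = (1 / z.im) ^ 2 := rfl

theorem measurable_hypDensity : Measurable hypDensity := by
  have h : Measurable fun z : ℍ => NNReal.mk z.im z.im_pos.le :=
    (UpperHalfPlane.continuous_im.subtype_mk _).measurable
  exact (measurable_const.div h).pow_const 2

theorem map_coe_restrict_comap (S : Set ℍ) :
    (((volume : Measure ℂ).comap UpperHalfPlane.coe).restrict S).map UpperHalfPlane.coe =
      volume.restrict (UpperHalfPlane.coe '' S) := by
  have he := UpperHalfPlane.measurableEmbedding_coe
  have h := he.restrict_map ((volume : Measure ℂ).comap UpperHalfPlane.coe)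
    (UpperHalfPlane.coe '' S)
  rw [preimage_image_eq _ he.injective] at h
  rw [← h, he.map_comap, Measure.restrict_restrict_of_subset (image_subset_range _ _)]

theorem volume_restrict_upperHalfPlane {S : Set ℍ} (hS : MeasurableSet S) :
    (volume : Measure ℍ).restrict S =
      (((volume : Measure ℂ).comap UpperHalfPlane.coe).restrict S).withDensity
        fun z => (hypDensity z : ENNReal) :=
  restrict_withDensity hS _

theorem integrableOn_upperHalfPlane_iff {S : Set ℍ} (hS : MeasurableSet S) (G : ℍ → ℂ) :
    IntegrableOn G S ↔ IntegrableOn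
      (fun w : ℂ => ((1 / w.im) ^ 2 : ℝ) • G (UpperHalfPlane.ofComplex w))
      (UpperHalfPlane.coe '' S) := by
  rw [IntegrableOn, IntegrableOn, volume_restrict_upperHalfPlane hS,
    integrable_withDensity_iff_integrable_smul measurable_hypDensity, ← map_coe_restrict_comap,
    UpperHalfPlane.measurableEmbedding_coe.integrable_map_iff]
  simp only [Function.comp_def, UpperHalfPlane.ofComplex_apply, UpperHalfPlane.coe_im,
    NNReal.smul_def, coe_hypDensity]

theorem setIntegral_upperHalfPlane {S : Set ℍ} (hS : MeasurableSet S) (G : ℍ → ℂ) :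
    ∫ z in S, G z = ∫ w in UpperHalfPlane.coe '' S,
      ((1 / w.im) ^ 2 : ℝ) • G (UpperHalfPlane.ofComplex w) := by
  rw [volume_restrict_upperHalfPlane hS,
    integral_withDensity_eq_integral_smul measurable_hypDensity, ← map_coe_restrict_comap,
    UpperHalfPlane.measurableEmbedding_coe.integral_map]
  simp only [UpperHalfPlane.ofComplex_apply, UpperHalfPlane.coe_im,
    NNReal.smul_def, coe_hypDensity]

/-- The inverse Cayley transform, which maps the unit disc onto the upper half-plane and `0`
to `i`. -/
def cayleyInv (ζ : ℂ) : ℂ := Complex.I * (1 + ζ) / (1 - ζ)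

theorem one_sub_ne_zero_of_norm_lt {ζ : ℂ} (h : ‖ζ‖ < 1) : 1 - ζ ≠ 0 := by
  intro h0
  rw [← sub_eq_zero.mp h0] at h
  simp at h

theorem cayleyInv_im {ζ : ℂ} (h : ‖ζ‖ < 1) :
    (cayleyInv ζ).im = (1 - ‖ζ‖ ^ 2) / ‖1 - ζ‖ ^ 2 := by
  have h0 := one_sub_ne_zero_of_norm_lt h
  have h1 : Complex.normSq (1 - ζ) ≠ 0 := by simpa using h0
  rw [cayleyInv, Complex.div_im, ← Complex.normSq_eq_norm_sq, ← Complex.normSq_eq_norm_sq]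
  field_simp
  simp [Complex.normSq_apply]
  ring

theorem cayleyInv_im_pos {ζ : ℂ} (h : ‖ζ‖ < 1) : 0 < (cayleyInv ζ).im := by
  have h0 := norm_pos_iff.mpr (one_sub_ne_zero_of_norm_lt h)
  have h1 : ‖ζ‖ ^ 2 < 1 := by nlinarith [norm_nonneg ζ]
  rw [cayleyInv_im h]
  have : 0 < 1 - ‖ζ‖ ^ 2 := by linarith
  positivity

theorem cayleyInv_add_I {ζ : ℂ} (h : ‖ζ‖ < 1) : cayleyInv ζ + Complex.I =
    2 * Complex.I / (1 - ζ) := by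
  have h0 := one_sub_ne_zero_of_norm_lt h
  rw [cayleyInv]
  field_simp
  ring

theorem cayleyInv_sub_I {ζ : ℂ} (h : ‖ζ‖ < 1) : cayleyInv ζ - Complex.I =
    2 * Complex.I * ζ / (1 - ζ) := by
  have h0 := one_sub_ne_zero_of_norm_lt h
  rw [cayleyInv]
  field_simp
  ring

theorem injOn_cayleyInv : InjOn cayleyInv (Metric.ball 0 1) := by
  intro ζ hζ ω hω h
  have hζ : ‖ζ‖ < 1 := by simpa using hζ
  have hω : ‖ω‖ < 1 := by simpa using hω
  have h1 := cayleyInv_add_I hζ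
  have h2 := cayleyInv_add_I hω
  rw [h, h2] at h1
  have h3 := one_sub_ne_zero_of_norm_lt hζ
  have h4 := one_sub_ne_zero_of_norm_lt hω
  have hI := Complex.I_ne_zero
  field_simp at h1
  linear_combination -h1

theorem hasDerivAt_cayleyInv {ζ : ℂ} (h : ‖ζ‖ < 1) :
    HasDerivAt cayleyInv (2 * Complex.I / (1 - ζ) ^ 2) ζ := by
  have h0 := one_sub_ne_zero_of_norm_lt h
  have h1 := (((hasDerivAt_id ζ).const_add 1).const_mul Complex.I).div
    ((hasDerivAt_id ζ).const_sub 1) h0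
  refine h1.congr_deriv ?_
  simp only [id]
  congr 1
  ring

theorem norm_pseudoDisc_quotient (w : ℂ) :
    ‖(Complex.I - w) / (Complex.I - conj w)‖ = ‖w - Complex.I‖ / ‖w + Complex.I‖ := by
  rw [norm_div, norm_sub_rev Complex.I w]
  congr 1
  rw [← Complex.norm_conj, map_sub, Complex.conj_conj, Complex.conj_I, ← norm_neg]
  congr 1
  ring

theorem measurableSet_pseudoDisc (R : ℝ) : MeasurableSet (pseudoDisc UpperHalfPlane.I R) := by
  unfold pseudoDisc
  refine measurableSet_lt ?_ measurable_const
  have := UpperHalfPlane.measurable_coe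
  have hc : Measurable fun w : ℍ => conj (w : ℂ) :=
    Complex.continuous_conj.measurable.comp this
  exact ((measurable_const.sub this).div (measurable_const.sub hc)).norm

theorem coe_image_pseudoDisc {R : ℝ} (hR : R ≤ 1) :
    UpperHalfPlane.coe '' pseudoDisc UpperHalfPlane.I R = cayleyInv '' Metric.ball 0 R := by
  ext w
  constructor
  · rintro ⟨w, hw, rfl⟩
    have hw : ‖(Complex.I - (w : ℂ)) / (Complex.I - conj (w : ℂ))‖ < R := hw
    rw [norm_pseudoDisc_quotient] at hw
    have hw0 : (w : ℂ) + Complex.I ≠ 0 := by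
      intro h
      have := congrArg Complex.im h
      have := w.im_pos
      simp at *
      linarith
    refine ⟨((w : ℂ) - Complex.I) / ((w : ℂ) + Complex.I), by simpa using hw, ?_⟩
    have e : (1 : ℂ) - ((w : ℂ) - Complex.I) / ((w : ℂ) + Complex.I) =
        2 * Complex.I / ((w : ℂ) + Complex.I) := by
      field_simp
      ring
    have hI := Complex.I_ne_zero
    rw [cayleyInv, e]
    field_simp
    ring
  · rintro ⟨ζ, hζ, rfl⟩
    have hζR : ‖ζ‖ < R := by simpa using hζ
    have hζ1 : ‖ζ‖ < 1 := hζR.trans_le hR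
    refine ⟨⟨cayleyInv ζ, cayleyInv_im_pos hζ1⟩, ?_, rfl⟩
    change ‖(Complex.I - cayleyInv ζ) / (Complex.I - conj (cayleyInv ζ))‖ < R
    have h0 := norm_pos_iff.mpr (one_sub_ne_zero_of_norm_lt hζ1)
    rw [norm_pseudoDisc_quotient, cayleyInv_add_I hζ1, cayleyInv_sub_I hζ1]
    simp only [norm_mul, norm_div, Complex.norm_I, Complex.norm_ofNat]
    convert hζR using 1
    field_simp

theorem hasFDerivWithinAt_cayleyInv {R : ℝ} (hR : R ≤ 1) :
    ∀ ζ ∈ Metric.ball (0 : ℂ) R, HasFDerivWithinAt cayleyInv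
      ((ContinuousLinearMap.toSpanSingleton ℂ (2 * Complex.I / (1 - ζ) ^ 2)).restrictScalars ℝ)
      (Metric.ball 0 R) ζ := by
  intro ζ hζ
  have hζ1 : ‖ζ‖ < 1 := lt_of_lt_of_le (by simpa using hζ) hR
  exact ((hasDerivAt_cayleyInv hζ1).hasFDerivAt.restrictScalars ℝ).hasFDerivWithinAt

/-- The Jacobian of the Cayley transform turns the invariant measure into `4 (1-|ζ|²)⁻² dζ`. -/
theorem abs_det_mul_inv_im_sq {ζ : ℂ} (hζ : ‖ζ‖ < 1) :
    |((ContinuousLinearMap.toSpanSingleton ℂ (2 * Complex.I / (1 - ζ) ^ 2)).restrictScalars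
      ℝ).det| * (1 / (cayleyInv ζ).im) ^ 2 = 4 / (1 - ‖ζ‖ ^ 2) ^ 2 := by
  have h0 := (norm_pos_iff.mpr (one_sub_ne_zero_of_norm_lt hζ)).ne'
  have h1 : 1 - ‖ζ‖ ^ 2 ≠ 0 := by nlinarith [norm_nonneg ζ]
  have hd : ((ContinuousLinearMap.toSpanSingleton ℂ (2 * Complex.I / (1 - ζ) ^ 2)).restrictScalars
      ℝ).det = 4 / ‖1 - ζ‖ ^ 4 := by
    simp [ContinuousLinearMap.det, LinearMap.det_restrictScalars,
      Algebra.norm_complex_eq, Complex.normSq_eq_norm_sq, ← pow_mul]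
    norm_num
  rw [hd, cayleyInv_im hζ, abs_of_nonneg (by positivity)]
  field_simp

theorem integrableOn_pseudoDisc_iff {R : ℝ} (hR : R ≤ 1) (G : ℍ → ℂ) :
    IntegrableOn G (pseudoDisc UpperHalfPlane.I R) ↔
      IntegrableOn (fun ζ : ℂ => (4 / (1 - ‖ζ‖ ^ 2) ^ 2 : ℝ) •
        G (UpperHalfPlane.ofComplex (cayleyInv ζ))) (Metric.ball 0 R) := by
  rw [integrableOn_upperHalfPlane_iff (measurableSet_pseudoDisc R), coe_image_pseudoDisc hR,
    integrableOn_image_iff_integrableOn_abs_det_fderiv_smul volume Metric.isOpen_ball.measurableSet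
      (hasFDerivWithinAt_cayleyInv hR) (injOn_cayleyInv.mono (Metric.ball_subset_ball hR))]
  refine integrableOn_congr_fun (fun ζ hζ => ?_) Metric.isOpen_ball.measurableSet
  have hζ1 : ‖ζ‖ < 1 := lt_of_lt_of_le (by simpa using hζ) hR
  rw [smul_smul, abs_det_mul_inv_im_sq hζ1]

theorem setIntegral_pseudoDisc {R : ℝ} (hR : R ≤ 1) (G : ℍ → ℂ) :
    ∫ z in pseudoDisc UpperHalfPlane.I R, G z =
      ∫ ζ in Metric.ball (0 : ℂ) R, (4 / (1 - ‖ζ‖ ^ 2) ^ 2 : ℝ) •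
        G (UpperHalfPlane.ofComplex (cayleyInv ζ)) := by
  rw [setIntegral_upperHalfPlane (measurableSet_pseudoDisc R), coe_image_pseudoDisc hR,
    integral_image_eq_integral_abs_det_fderiv_smul volume Metric.isOpen_ball.measurableSet
      (hasFDerivWithinAt_cayleyInv hR) (injOn_cayleyInv.mono (Metric.ball_subset_ball hR))]
  refine setIntegral_congr_fun Metric.isOpen_ball.measurableSet fun ζ hζ => ?_
  have hζ1 : ‖ζ‖ < 1 := lt_of_lt_of_le (by simpa using hζ) hR
  rw [smul_smul, abs_det_mul_inv_im_sq hζ1]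

/-! ### The wavelet transforms in the disc model -/

/-- The wavelet transform of `ψ_m` with window `ψ_n` in the disc coordinate `ζ`, up to the constant
`ampl α m n` and factors that do not depend on `m`. It is a polynomial in `ζ` and `conj ζ`. -/
def discPoly (α : ℝ) (m n : ℕ) (ζ : ℂ) : ℂ :=
  ∑ k ∈ Finset.range (n + 1), (coef (α + 1) m n k : ℂ) * ((-(1 - ‖ζ‖ ^ 2) : ℝ) : ℂ) ^ k *
    ζ ^ (m - k) * conj ζ ^ (n - k)

theorem continuous_discPoly (α : ℝ) (m n : ℕ) : Continuous (discPoly α m n) := by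
  have := Complex.continuous_conj
  unfold discPoly
  fun_prop

/-- The closed form of the wavelet transform at `z = cayleyInv ζ`, where `p = 2/(1 - ζ)`. -/
theorem waveletTransform_cayleyInv {α : ℝ} (hα : 0 < α) (n m : ℕ) {ζ : ℂ} (hζ : ‖ζ‖ < 1) :
    waveletTransform (psi α hα n) (psi α hα m) (UpperHalfPlane.ofComplex (cayleyInv ζ)) =
      (ampl α m n : ℂ) * (((cayleyInv ζ).im ^ ((α + 1) / 2) : ℝ) : ℂ) *
        (2 / (1 - ζ)) ^ (-((α + 1 : ℝ) : ℂ)) * (-(1 - ζ) / (1 - conj ζ)) ^ n *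
        discPoly α m n ζ := by
  have hz := cayleyInv_im_pos hζ
  have h0 := one_sub_ne_zero_of_norm_lt hζ
  have h0' : 1 - conj ζ ≠ 0 := one_sub_ne_zero_of_norm_lt (by simpa using hζ)
  have hre : (UpperHalfPlane.ofComplex (cayleyInv ζ)).re = (cayleyInv ζ).re := by
    rw [UpperHalfPlane.ofComplex_apply_of_im_pos hz]
    rfl
  have him : (UpperHalfPlane.ofComplex (cayleyInv ζ)).im = (cayleyInv ζ).im := by
    rw [UpperHalfPlane.ofComplex_apply_of_im_pos hz]
    rfl
  have hp : 2 / (1 - ζ) = 1 + ((cayleyInv ζ).im : ℂ) - (cayleyInv ζ).re * Complex.I := by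
    have h1 := cayleyInv_add_I hζ
    have h2 := Complex.re_add_im (cayleyInv ζ)
    linear_combination Complex.I * h1 + Complex.I * h2 +
      (2 / (1 - ζ) - 1 - (cayleyInv ζ).im) * Complex.I_sq
  have hs : ((cayleyInv ζ).im : ℂ) = (1 - ζ * conj ζ) / ((1 - ζ) * (1 - conj ζ)) := by
    have e : (1 - ζ) * (1 - conj ζ) = ((‖1 - ζ‖ ^ 2 : ℝ) : ℂ) := by
      rw [show 1 - conj ζ = conj (1 - ζ) by simp, Complex.mul_conj, Complex.normSq_eq_norm_sq]
    rw [cayleyInv_im hζ, e, Complex.mul_conj, Complex.normSq_eq_norm_sq]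
    push_cast
    rfl
  have hn : ((-(1 - ‖ζ‖ ^ 2) : ℝ) : ℂ) = -(1 - ζ * conj ζ) := by
    rw [Complex.mul_conj, Complex.normSq_eq_norm_sq]
    push_cast
    rfl
  rw [waveletTransform_psi hα n m _ (p := 2 / (1 - ζ)) (by rw [hre, him, hp]), him]
  rw [mul_assoc _ (_ ^ n)]
  congr 1
  rw [discPoly, Finset.mul_sum]
  refine Finset.sum_congr rfl fun k hk => ?_
  have hkn : k ≤ n := Nat.lt_succ_iff.mp (Finset.mem_range.mp hk)
  have e1 : 1 - 2 / (2 / (1 - ζ)) = ζ := by field_simp; ring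
  have e2 : 1 - 2 * ((cayleyInv ζ).im : ℂ) / (2 / (1 - ζ)) =
      -(1 - ζ) / (1 - conj ζ) * conj ζ := by
    rw [hs]
    field_simp
    ring
  have e3 : 2 / (2 / (1 - ζ)) * (2 * ((cayleyInv ζ).im : ℂ) / (2 / (1 - ζ))) =
      -(1 - ζ) / (1 - conj ζ) * -(1 - ζ * conj ζ) := by
    rw [hs]
    field_simp
  rw [e1, e2, e3, hn, mul_pow, mul_pow]
  rw [← pow_sub_mul_pow (-(1 - ζ) / (1 - conj ζ)) hkn]
  ring

/-- The modulus of the factors in front of `discPoly`: `Im z / |p|² = (1 - |ζ|²)/4`. -/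
theorem cayleyInv_im_rpow_mul_norm {α : ℝ} {ζ : ℂ} (hζ : ‖ζ‖ < 1) :
    ((cayleyInv ζ).im ^ ((α + 1) / 2)) ^ 2 * ‖(2 / (1 - ζ)) ^ (-((α + 1 : ℝ) : ℂ))‖ ^ 2 =
      ((1 - ‖ζ‖ ^ 2) / 4) ^ (α + 1) := by
  have h0 := norm_pos_iff.mpr (one_sub_ne_zero_of_norm_lt hζ)
  have hs := cayleyInv_im_pos hζ
  rw [← Complex.ofReal_neg, Complex.norm_cpow_real, ← Real.rpow_natCast (_ ^ _),
    ← Real.rpow_mul hs.le,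
    ← Real.rpow_natCast (_ ^ _), ← Real.rpow_mul (norm_nonneg _), norm_div, Complex.norm_ofNat]
  rw [show (α + 1) / 2 * ((2 : ℕ) : ℝ) = α + 1 by push_cast; ring,
    show -(α + 1) * ((2 : ℕ) : ℝ) = (2 : ℕ) * (-(α + 1)) by ring,
    Real.rpow_mul (by positivity), Real.rpow_neg (by positivity), ← Real.inv_rpow (by positivity),
    ← Real.mul_rpow hs.le (by positivity), Real.rpow_natCast, cayleyInv_im hζ]
  congr 1
  field_simp
  norm_num

/-- The product of two wavelet transforms against the invariant measure. The complex power of `p`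
and the unimodular factor enter only through their moduli. -/
theorem wavelet_product_disc {α : ℝ} (hα : 0 < α) (n m k : ℕ) {ζ : ℂ} (hζ : ‖ζ‖ < 1) :
    (4 / (1 - ‖ζ‖ ^ 2) ^ 2 : ℝ) •
      (waveletTransform (psi α hα n) (psi α hα m) (UpperHalfPlane.ofComplex (cayleyInv ζ)) *
        conj (waveletTransform (psi α hα n) (psi α hα k)
          (UpperHalfPlane.ofComplex (cayleyInv ζ)))) =
      ((ampl α m n * ampl α k n * 4 ^ (-α) * (1 - ‖ζ‖ ^ 2) ^ (α - 1) : ℝ) : ℂ) *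
        (discPoly α m n ζ * conj (discPoly α k n ζ)) := by
  have h0 := one_sub_ne_zero_of_norm_lt hζ
  have h1 : 0 < 1 - ‖ζ‖ ^ 2 := by nlinarith [norm_nonneg ζ]
  have hε : (-(1 - ζ) / (1 - conj ζ)) * conj (-(1 - ζ) / (1 - conj ζ)) = 1 := by
    have h0' : 1 - conj ζ ≠ 0 := one_sub_ne_zero_of_norm_lt (by simpa using hζ)
    simp only [map_div₀, map_neg, map_sub, map_one, Complex.conj_conj]
    field_simp
  have hε' : (-(1 - ζ) / (1 - conj ζ)) ^ n * conj (-(1 - ζ) / (1 - conj ζ)) ^ n = 1 := by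
    rw [← mul_pow, hε, one_pow]
  have hP : ∀ P : ℂ, P * conj P = ((‖P‖ ^ 2 : ℝ) : ℂ) := fun P => by
    rw [Complex.mul_conj, Complex.normSq_eq_norm_sq]
  have hr : 4 / (1 - ‖ζ‖ ^ 2) ^ 2 * ((1 - ‖ζ‖ ^ 2) / 4) ^ (α + 1) =
      4 ^ (-α) * (1 - ‖ζ‖ ^ 2) ^ (α - 1) := by
    rw [Real.div_rpow h1.le (by norm_num), show α + 1 = (α - 1) + (2 : ℕ) by push_cast; ring,
      Real.rpow_add_natCast h1.ne', show α - 1 + ((2 : ℕ) : ℝ) = α + (1 : ℕ) by push_cast; ring,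
      Real.rpow_add_natCast (by norm_num : (4 : ℝ) ≠ 0), Real.rpow_neg (by norm_num)]
    field_simp
  rw [waveletTransform_cayleyInv hα n m hζ, waveletTransform_cayleyInv hα n k hζ]
  have hX := cayleyInv_im_rpow_mul_norm (α := α) hζ
  simp only [map_mul, map_pow, Complex.conj_ofReal, Complex.real_smul]
  generalize (2 / (1 - ζ)) ^ (-((α + 1 : ℝ) : ℂ)) = P at hX ⊢
  generalize (cayleyInv ζ).im ^ ((α + 1) / 2) = S at hX ⊢
  rw [mul_assoc (ampl α m n * ampl α k n), ← hr, ← hX]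
  push_cast
  have hPP := hP P
  push_cast at hPP
  rw [← hPP]
  linear_combination (4 / (1 - (‖ζ‖ : ℂ) ^ 2) ^ 2 * ampl α m n * ampl α k n * S ^ 2 *
    (P * conj P) * discPoly α m n ζ * conj (discPoly α k n ζ)) * hε'

/-- In polar coordinates `discPoly` splits into a phase and a real radial factor. -/
theorem discPoly_polar (α : ℝ) (m n : ℕ) {ρ : ℝ} (hρ : 0 ≤ ρ) {E : ℂ} (hE : ‖E‖ = 1) :
    discPoly α m n (ρ * E) =
      E ^ m * conj E ^ n * ((ρ ^ (max m n - min m n) * radial α m n (ρ ^ 2) : ℝ) : ℂ) := by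
  have hEE : E * conj E = 1 := by
    rw [Complex.mul_conj, Complex.normSq_eq_norm_sq, hE]
    simp
  have hnorm : ‖(ρ : ℂ) * E‖ = ρ := by
    rw [norm_mul, hE, mul_one, Complex.norm_real, Real.norm_of_nonneg hρ]
  rw [discPoly, hnorm, radial, Finset.mul_sum, Complex.ofReal_sum, Finset.mul_sum]
  rw [← Finset.sum_subset (Finset.range_subset_range.mpr
    (Nat.succ_le_succ (min_le_right m n)))]
  · refine Finset.sum_congr rfl fun k hk => ?_
    have hk : k ≤ min m n := Nat.lt_succ_iff.mp (Finset.mem_range.mp hk)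
    have hkm : k ≤ m := hk.trans (min_le_left _ _)
    have hkn : k ≤ n := hk.trans (min_le_right _ _)
    have e1 : E ^ m * conj E ^ n = E ^ (m - k) * conj E ^ (n - k) := by
      rw [← pow_sub_mul_pow E hkm, ← pow_sub_mul_pow (conj E) hkn]
      have : E ^ k * conj E ^ k = 1 := by rw [← mul_pow, hEE, one_pow]
      linear_combination (E ^ (m - k) * conj E ^ (n - k)) * this
    have e2 : (ρ : ℂ) ^ (m - k) * (ρ : ℂ) ^ (n - k) =
        (ρ : ℂ) ^ (max m n - min m n) * ((ρ : ℂ) ^ 2) ^ (min m n - k) := by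
      rw [← pow_mul, ← pow_add, ← pow_add]
      congr 1
      omega
    simp only [map_mul, Complex.conj_ofReal, mul_pow]
    rw [e1]
    push_cast
    linear_combination ((coef (α + 1) m n k : ℂ) * (-(1 - (ρ : ℂ) ^ 2)) ^ k *
      E ^ (m - k) * conj E ^ (n - k)) * e2
  · intro k hk hk'
    have hkn : k < n + 1 := Finset.mem_range.mp hk
    have hkm : m < k := by
      simp only [Finset.mem_range] at hk'
      omega
    rw [coef_eq_zero_left hkm]
    simp

/-! ### Integration over the disc -/

/-- The integral over a disc of a function that splits in polar coordinates. -/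
theorem setIntegral_ball_of_polar {R : ℝ} (hR : 0 < R) {F : ℂ → ℂ} {f g : ℝ → ℂ}
    (h : ∀ ρ θ : ℝ, 0 < ρ → ρ < R → F (ρ * Complex.exp (θ * Complex.I)) = f ρ * g θ) :
    ∫ ζ in Metric.ball (0 : ℂ) R, F ζ =
      (∫ ρ in (0 : ℝ)..R, (ρ : ℂ) * f ρ) * ∫ θ in (-Real.pi)..Real.pi, g θ := by
  rw [← integral_indicator Metric.isOpen_ball.measurableSet,
    ← Complex.integral_comp_polarCoord_symm, polarCoord_target]
  have step : ∀ p ∈ Ioi (0 : ℝ) ×ˢ Ioo (-Real.pi) Real.pi,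
      p.1 • (Metric.ball (0 : ℂ) R).indicator F (Complex.polarCoord.symm p) =
        (Iio R).indicator (fun ρ : ℝ => (ρ : ℂ) * f ρ) p.1 * g p.2 := by
    rintro ⟨ρ, θ⟩ ⟨hρ, -⟩
    have hρ : 0 < ρ := hρ
    have hn := Complex.norm_polarCoord_symm (ρ, θ)
    rw [abs_of_pos hρ] at hn
    by_cases hρR : ρ < R
    · have h1 : Complex.polarCoord.symm (ρ, θ) ∈ Metric.ball (0 : ℂ) R := by
        rwa [mem_ball_zero_iff, hn]
      rw [indicator_of_mem h1, indicator_of_mem (mem_Iio.mpr hρR), Complex.polarCoord_symm_apply,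
        Complex.ofReal_cos, Complex.ofReal_sin, ← Complex.exp_mul_I, h ρ θ hρ hρR,
        Complex.real_smul, mul_assoc]
    · have h1 : Complex.polarCoord.symm (ρ, θ) ∉ Metric.ball (0 : ℂ) R := by
        rwa [mem_ball_zero_iff, hn]
      rw [indicator_of_notMem h1, indicator_of_notMem (by simpa using hρR)]
      simp
  rw [setIntegral_congr_fun (measurableSet_Ioi.prod measurableSet_Ioo) step,
    Measure.volume_eq_prod, setIntegral_prod_mul, setIntegral_indicator measurableSet_Iio,
    Ioi_inter_Iio, intervalIntegral.integral_of_le hR.le,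
    intervalIntegral.integral_of_le (by linarith [Real.pi_pos]), integral_Ioc_eq_integral_Ioo,
    integral_Ioc_eq_integral_Ioo]

/-- Orthogonality of the phases over the circle. -/
theorem integral_phase (m k : ℕ) :
    ∫ θ in (-Real.pi)..Real.pi, Complex.exp (θ * Complex.I) ^ m *
      conj (Complex.exp (θ * Complex.I)) ^ k = if m = k then (2 * Real.pi : ℂ) else 0 := by
  have e : ∀ θ : ℝ, Complex.exp (θ * Complex.I) ^ m * conj (Complex.exp (θ * Complex.I)) ^ k =
      Complex.exp (((m : ℂ) - k) * Complex.I * θ) := by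
    intro θ
    rw [← Complex.exp_conj, ← Complex.exp_nat_mul, ← Complex.exp_nat_mul, ← Complex.exp_add]
    congr 1
    simp only [map_mul, Complex.conj_ofReal, Complex.conj_I]
    ring
  simp_rw [e]
  split_ifs with h
  · subst h
    simp
    ring
  · have hc : ((m : ℂ) - k) * Complex.I ≠ 0 :=
      mul_ne_zero (sub_ne_zero.mpr (by exact_mod_cast h)) Complex.I_ne_zero
    rw [integral_exp_mul_complex hc, div_eq_zero_iff]
    left
    have e2 : ((m : ℂ) - k) * Complex.I * (Real.pi : ℝ) =
        ((m : ℂ) - k) * Complex.I * ((-Real.pi : ℝ) : ℂ) +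
          ((m - k : ℤ) : ℂ) * (2 * Real.pi * Complex.I) := by
      push_cast
      ring
    rw [e2, Complex.exp_add, Complex.exp_int_mul_two_pi_mul_I, mul_one, sub_self]

/-- The radial weight: away from `r = 0` it is the integrand of `localConst`. -/
def radialWeight (α : ℝ) (m n : ℕ) (r : ℝ) : ℝ :=
  Real.Gamma (m + α + 1) * Real.Gamma (n + α + 1) / (m.factorial * n.factorial) *
    ((1 - r) ^ (α - 1) * (r ^ (max m n - min m n) * radial α m n r ^ 2))

theorem continuousOn_radialWeight (α : ℝ) (m n : ℕ) :
    ContinuousOn (radialWeight α m n) (Iio 1) := by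
  have h1 : ContinuousOn (fun r : ℝ => (1 - r) ^ (α - 1)) (Iio 1) :=
    ContinuousOn.rpow_const (by fun_prop) fun r hr => Or.inl (sub_pos.mpr hr).ne'
  have h2 : Continuous (radial α m n) := by
    unfold radial
    fun_prop
  unfold radialWeight
  fun_prop

theorem localConst_integrand_eq {α : ℝ} (hα : 0 < α) (m n : ℕ) {r : ℝ} (hr : r ≠ 0) :
    r ^ (m + n) * (1 - r) ^ (α - 1) * zernike α m n r ^ 2 = radialWeight α m n r := by
  rw [radialWeight, mul_right_comm, pow_mul_zernike_sq hα m n hr]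
  ring

/-- The normalizations match: all powers of `2` and `π` combine to the factor `4`. -/
theorem ampl_sq {α : ℝ} (hα : 0 < α) (m n : ℕ) :
    ampl α m n * ampl α m n * 4 ^ (-α) =
      4 * (Real.Gamma (m + α + 1) * Real.Gamma (n + α + 1) / (m.factorial * n.factorial)) := by
  have hm : 0 < Real.Gamma (m + α + 1) := Real.Gamma_pos_of_pos (by positivity)
  have hn : 0 < Real.Gamma (n + α + 1) := Real.Gamma_pos_of_pos (by positivity)
  have hc : ∀ l : ℕ, normConst α l ^ 2 =
      (2 : ℝ) ^ (α + 2) * Real.pi * l.factorial / Real.Gamma (l + α + 1) := fun l =>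
    Real.sq_sqrt (div_nonneg (by positivity) (Real.Gamma_nonneg_of_nonneg (by positivity)))
  have h4 : (4 : ℝ) ^ (-α) * ((2 : ℝ) ^ (α + 2) * (2 : ℝ) ^ (α + 2)) = 16 := by
    rw [← Real.mul_rpow (by norm_num) (by norm_num), show (2 : ℝ) * 2 = 4 by norm_num,
      ← Real.rpow_add (by norm_num), show -α + (α + 2) = ((2 : ℕ) : ℝ) by push_cast; ring,
      Real.rpow_natCast]
    norm_num
  have e : ampl α m n * ampl α m n = normConst α m ^ 2 * normConst α n ^ 2 *
      ((Real.Gamma (m + α + 1) * Real.Gamma (n + α + 1)) /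
        (2 * Real.pi * (m.factorial * n.factorial))) ^ 2 := by
    unfold ampl
    ring
  rw [e, hc, hc]
  have hpi := Real.pi_pos
  have hm' := hm.ne'
  have hn' := hn.ne'
  field_simp
  linear_combination h4

/-- The substitution `r = ρ²` in the radial integral. -/
theorem integral_radial_eq {α : ℝ} (hα : 0 < α) (m n : ℕ) {R : ℝ} (hR0 : 0 < R) (hR1 : R < 1) :
    ∫ ρ in (0 : ℝ)..R, ρ * (ampl α m n * ampl α m n * 4 ^ (-α) * (1 - ρ ^ 2) ^ (α - 1) *
      (ρ ^ (max m n - min m n) * radial α m n (ρ ^ 2)) ^ 2) =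
      2 * ∫ r in (0 : ℝ)..R ^ 2, radialWeight α m n r := by
  have h := intervalIntegral.integral_comp_mul_deriv' (a := 0) (b := R)
    (f := fun ρ : ℝ => ρ ^ 2) (f' := fun ρ => 2 * ρ) (g := radialWeight α m n)
    (fun ρ _ => by simpa using hasDerivAt_pow 2 ρ) (by fun_prop)
    ((continuousOn_radialWeight α m n).mono (by
      rintro _ ⟨ρ, hρ, rfl⟩
      rw [uIcc_of_le hR0.le] at hρ
      have : ρ < 1 := hρ.2.trans_lt hR1
      simp only [mem_Iio]
      nlinarith [hρ.1]))
  simp only [Function.comp_def, ne_eq, OfNat.ofNat_ne_zero, not_false_eq_true, zero_pow] at h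
  rw [← h, ← intervalIntegral.integral_const_mul]
  refine intervalIntegral.integral_congr fun ρ _ => ?_
  simp only [radialWeight]
  rw [ampl_sq hα, mul_pow, ← pow_mul, mul_comm _ 2, pow_mul]
  ring

/-! ### Local orthogonality -/

theorem integrableOn_wavelet_product {α : ℝ} (hα : 0 < α) {R : ℝ} (hR1 : R < 1) (n m k : ℕ) :
    IntegrableOn (fun z : ℍ => waveletTransform (psi α hα n) (psi α hα m) z *
      conj (waveletTransform (psi α hα n) (psi α hα k) z)) (pseudoDisc UpperHalfPlane.I R) := by
  rw [integrableOn_pseudoDisc_iff hR1.le]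
  have hc : ContinuousOn (fun ζ : ℂ =>
      ((ampl α m n * ampl α k n * 4 ^ (-α) * (1 - ‖ζ‖ ^ 2) ^ (α - 1) : ℝ) : ℂ) *
        (discPoly α m n ζ * conj (discPoly α k n ζ))) (Metric.closedBall 0 R) := by
    have h1 : ContinuousOn (fun ζ : ℂ => (1 - ‖ζ‖ ^ 2) ^ (α - 1)) (Metric.closedBall 0 R) := by
      refine ContinuousOn.rpow_const (by fun_prop) fun ζ hζ => Or.inl ?_
      have h2 : ‖ζ‖ < 1 := lt_of_le_of_lt (by simpa using hζ) hR1
      nlinarith [norm_nonneg ζ]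
    have h2 := continuous_discPoly α m n
    have h3 := Complex.continuous_conj.comp (continuous_discPoly α k n)
    exact (Complex.continuous_ofReal.comp_continuousOn (continuousOn_const.mul h1)).mul
      (h2.mul h3).continuousOn
  refine ((hc.integrableOn_compact (isCompact_closedBall 0 R)).mono_set
    Metric.ball_subset_closedBall).congr_fun (fun ζ hζ => ?_) Metric.isOpen_ball.measurableSet
  exact (wavelet_product_disc hα n m k
    ((show ‖ζ‖ < R by simpa using hζ).trans hR1)).symm

theorem setIntegral_wavelet_product {α : ℝ} (hα : 0 < α) {R : ℝ} (hR0 : 0 < R) (hR1 : R < 1)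
    (n m k : ℕ) :
    ∫ z in pseudoDisc UpperHalfPlane.I R, waveletTransform (psi α hα n) (psi α hα m) z *
      conj (waveletTransform (psi α hα n) (psi α hα k) z) =
    if m = k then ((4 * Real.pi * ∫ r in (0 : ℝ)..R ^ 2, radialWeight α m n r : ℝ) : ℂ) else 0 := by
  rw [setIntegral_pseudoDisc hR1.le, setIntegral_congr_fun Metric.isOpen_ball.measurableSet
    fun ζ hζ => wavelet_product_disc hα n m k ((show ‖ζ‖ < R by simpa using hζ).trans hR1)]
  have hpolar := setIntegral_ball_of_polar (R := R) hR0
    (F := fun ζ => ((ampl α m n * ampl α k n * 4 ^ (-α) * (1 - ‖ζ‖ ^ 2) ^ (α - 1) : ℝ) : ℂ) *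
        (discPoly α m n ζ * conj (discPoly α k n ζ)))
    (f := fun ρ => ((ampl α m n * ampl α k n * 4 ^ (-α) * (1 - ρ ^ 2) ^ (α - 1) *
      ((ρ ^ (max m n - min m n) * radial α m n (ρ ^ 2)) *
        (ρ ^ (max k n - min k n) * radial α k n (ρ ^ 2))) : ℝ) : ℂ))
    (g := fun θ => Complex.exp (θ * Complex.I) ^ m * conj (Complex.exp (θ * Complex.I)) ^ k)
    (by
      intro ρ θ hρ _
      have hE : ‖Complex.exp (θ * Complex.I)‖ = 1 := Complex.norm_exp_ofReal_mul_I θ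
      have hnorm : ‖(ρ : ℂ) * Complex.exp (θ * Complex.I)‖ = ρ := by
        rw [norm_mul, hE, mul_one, Complex.norm_real, Real.norm_of_nonneg hρ.le]
      simp only [hnorm]
      rw [discPoly_polar α m n hρ.le hE, discPoly_polar α k n hρ.le hE]
      generalize Complex.exp (θ * Complex.I) = E at hE
      have hEE : E ^ n * conj E ^ n = 1 := by
        rw [← mul_pow, Complex.mul_conj, Complex.normSq_eq_norm_sq, hE]
        simp
      simp only [map_mul, map_pow, Complex.conj_conj, Complex.conj_ofReal, Complex.ofReal_mul]
      generalize ((ρ ^ (max m n - min m n) : ℝ) : ℂ) * ((radial α m n (ρ ^ 2) : ℝ) : ℂ) = A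
      generalize ((ρ ^ (max k n - min k n) : ℝ) : ℂ) * ((radial α k n (ρ ^ 2) : ℝ) : ℂ) = B
      generalize (ampl α m n : ℂ) * (ampl α k n : ℂ) * ((4 ^ (-α) : ℝ) : ℂ) *
        (((1 - ρ ^ 2) ^ (α - 1) : ℝ) : ℂ) = D
      linear_combination (D * A * B * E ^ m * conj E ^ k) * hEE)
  refine hpolar.trans ?_
  rw [integral_phase]
  split_ifs with h
  · subst h
    have hr := integral_radial_eq hα m n hR0 hR1
    simp_rw [← pow_two (_ * radial α m n _), ← Complex.ofReal_mul]
    rw [intervalIntegral.integral_ofReal, hr]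
    push_cast
    ring
  · rw [mul_zero]

end WaveletOrth

end


theorem mainTheorem3 (α : ℝ) (hα : 0 < α) (R : ℝ) (hR0 : 0 < R) (hR1 : R < 1) (n m k : ℕ) :
    (MeasureTheory.IntegrableOn
      (fun z : UpperHalfPlane =>
        WaveletOrth.waveletTransform (WaveletOrth.psi α hα n) (WaveletOrth.psi α hα m) z *
          (starRingEnd ℂ)
            (WaveletOrth.waveletTransform (WaveletOrth.psi α hα n) (WaveletOrth.psi α hα k) z))
      (WaveletOrth.pseudoDisc UpperHalfPlane.I R) MeasureTheory.volume) ∧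
    (∫ z in WaveletOrth.pseudoDisc UpperHalfPlane.I R,
        WaveletOrth.waveletTransform (WaveletOrth.psi α hα n) (WaveletOrth.psi α hα m) z *
          (starRingEnd ℂ)
            (WaveletOrth.waveletTransform (WaveletOrth.psi α hα n) (WaveletOrth.psi α hα k) z)) =
      (if m = k then ((WaveletOrth.localConst α m n R : ℝ) : ℂ) else 0) ∧
    IntervalIntegrable
      (fun r : ℝ => r ^ (m + n) * (1 - r) ^ (α - 1) * WaveletOrth.zernike α m n r ^ 2)
      MeasureTheory.volume 0 (R ^ 2) ∧
    WaveletOrth.localConst α n n R =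
      4 * Real.pi * ∫ r in (0 : ℝ)..R ^ 2,
        (1 - r) ^ (α - 1) * WaveletOrth.jacobi n 0 α (1 - 2 * r) ^ 2 := by
  have hR2 : 0 ≤ R ^ 2 := sq_nonneg R
  -- At `r = 0` the value of `zernike` is a junk value of `0⁻¹`, so the comparison is on `(0, R²]`.
  have hne : ∀ r ∈ Set.Ioc (0 : ℝ) (R ^ 2), r ≠ 0 := fun r hr => hr.1.ne'
  have hweight : ∫ r in (0 : ℝ)..R ^ 2, WaveletOrth.radialWeight α m n r =
      ∫ r in (0 : ℝ)..R ^ 2, r ^ (m + n) * (1 - r) ^ (α - 1) * WaveletOrth.zernike α m n r ^ 2 := by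
    rw [intervalIntegral.integral_of_le hR2, intervalIntegral.integral_of_le hR2]
    exact setIntegral_congr_fun measurableSet_Ioc fun r hr =>
      (WaveletOrth.localConst_integrand_eq hα m n (hne r hr)).symm
  refine ⟨WaveletOrth.integrableOn_wavelet_product hα hR1 n m k, ?_, ?_, ?_⟩
  · rw [WaveletOrth.setIntegral_wavelet_product hα hR0 hR1, hweight]
    rfl
  · have hi : IntervalIntegrable (WaveletOrth.radialWeight α m n) volume 0 (R ^ 2) := by
      refine ((WaveletOrth.continuousOn_radialWeight α m n).mono ?_).intervalIntegrable
      intro r hr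
      rw [Set.uIcc_of_le hR2] at hr
      simp only [Set.mem_Iio]
      nlinarith [hr.2]
    rw [intervalIntegrable_iff_integrableOn_Ioc_of_le hR2] at hi ⊢
    exact hi.congr_fun (fun r hr =>
      (WaveletOrth.localConst_integrand_eq hα m n (hne r hr)).symm) measurableSet_Ioc
  · rw [WaveletOrth.localConst, intervalIntegral.integral_of_le hR2,
      intervalIntegral.integral_of_le hR2]
    congr 1
    refine setIntegral_congr_fun measurableSet_Ioc fun r hr => ?_
    rw [mul_right_comm, WaveletOrth.pow_mul_zernike_self_sq hα n (hne r hr), mul_comm]
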